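/- Let $Q$ be a smooth manifold (Hausdorff, second countable) of dimension $n$, and let $G$ be a connected Lie group of dimension $d$ acting smoothly, freely and properly on $Q$ from the left by $\Phi_g(q)=gq$. Let $G$ act on $TQ\times\mathbb{R}$ by $\Phi^{TQ\times\mathbb{R}}_g(v_q,s)=(T\Phi_g(v_q),s)$. Let $L:TQ\times\mathbb{R}\to\mathbb{R}$ be a smooth function that is invariant, $L\circ\Phi^{TQ\times\mathbb{R}}_g=L$ for all $g\in G$, and regular: in natural coordinates $(q^\alpha,u^\alpha,s)$ the matrix $\left(\partial^2L/\partial u^\alpha\partial u^\beta\right)$ is everywhere nonsingular. Let $S=\frac{\partial}{\partial u^\alpha}\otimes dq^\alpha$ and $\Delta=u^\alpha\frac{\partial}{\partial u^\alpha}$ be the canonical tangent structure and the Liouville vector field, extended to $TQ\times\mathbb{R}$, and put $\eta_L=ds-dL\circ S$, $E_L=\Delta(L)-L$ and $\flat_L(Z)=i_Zd\eta_L+\eta_L(Z)\,\eta_L$. Let $\Gamma$ be the Herglotz vector field (Herglotz SODE) of $L$, that is, the smooth vector field on $TQ\times\mathbb{R}$ determined by $$\flat_L(\Gamma)=dE_L+\left(\frac{\partial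 L}{\partial s}-E_L\right)\eta_L .$$ Then $\Gamma$ is $G$-invariant: 1. $[\xi_Q^C,\Gamma]=0$ for every $\xi$ in the Lie algebra of $G$. Here $\xi_Q(q)=\frac{d}{dt}\big|_{t=0}\exp(t\xi)q$ is the fundamental vector field of $\xi$ on $Q$, and $X^C=X^\alpha\frac{\partial}{\partial q^\alpha}+u^\beta\frac{\partial X^\alpha}{\partial q^\beta}\frac{\partial}{\partial u^\alpha}$ is the complete lift to $TQ\times\mathbb{R}$ of a vector field $X$ on $Q$. 2. $T\Phi^{TQ\times\mathbb{R}}_g(\Gamma(p))=\Gamma(\Phi^{TQ\times\mathbb{R}}_g(p))$ for all $g\in G$ and $p\in TQ\times\mathbb{R}$. Hence $\Gamma$ descends to the quotient: the orbit space $TQ/G$, with the quotient topology, is Hausdorff and second countable and carries the structure of a smooth manifold of dimension $2n-d$ for which the projection $TQ\to TQ/G$ is a smooth submersion, and there is a unique smooth vector field $\breve\Gamma$ on $TQ/G\times\mathbb{R}$ such that, for all $v_q\in TQ$ and $s\in\mathbb{R}$, $$T\pi\left(\Gamma(v_q,s)\right)=\breve\Gamma([v_q],s),\qquad \pi:TQ\times\mathbb{R}\to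 TQ/G\times\mathbb{R},\quad \pi(v_q,s)=([v_q],s).$$ -/

import Mathlib

open scoped Manifold ContDiff

noncomputable section

namespace ContactReduction

section OneForms

variable {E : Type*} [NormedAddCommGroup E] [NormedSpace ℝ E] {H : Type*} [TopologicalSpace H]
  (I : ModelWithCorners ℝ E H) {M : Type*} [TopologicalSpace M] [ChartedSpace H M]

/-- The exterior derivative of a 1-form `α` on a manifold, evaluated on two tangent vectors at `x`.
The form is written in the preferred chart `φ` around `x` as a map `E → E →L[ℝ] ℝ`, and
`dα(v, w) = D_v α (w) - D_w α (v)` is computed there. -/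
def extDerivOneForm (α : (x : M) → TangentSpace I x →L[ℝ] ℝ) (x : M) (v w : TangentSpace I x) :
    ℝ :=
  let φ := extChartAt I x
  let αφ : E → E →L[ℝ] ℝ := fun y =>
    (α (φ.symm y)).comp (mfderivWithin 𝓘(ℝ, E) I φ.symm (Set.range I) y)
  let A : E →L[ℝ] E →L[ℝ] ℝ := fderivWithin ℝ αφ (Set.range I) (φ x)
  let v' : E := mfderiv I 𝓘(ℝ, E) φ x v
  let w' : E := mfderiv I 𝓘(ℝ, E) φ x w
  A v' w' - A w' v'

/-- A vector field is smooth if it is a smooth section of the tangent bundle. -/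
def IsSmoothVectorField [IsManifold I 1 M] (X : (x : M) → TangentSpace I x) : Prop :=
  ContMDiff I I.tangent ∞ (fun x => (⟨x, X x⟩ : TangentBundle I M))

end OneForms

section Lagrangian

variable {E : Type*} [NormedAddCommGroup E] [NormedSpace ℝ E] {H : Type*} [TopologicalSpace H]
  (I : ModelWithCorners ℝ E H) (Q : Type*) [TopologicalSpace Q] [ChartedSpace H Q]

/-- The phase space `TQ × ℝ`. -/
abbrev TQR : Type _ := TangentBundle I Q × ℝ

/-- The model with corners of `TQ × ℝ`. -/
abbrev modelTQR : ModelWithCorners ℝ ((E × E) × ℝ) (ModelProd (ModelProd H E) ℝ) :=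
  I.tangent.prod 𝓘(ℝ, ℝ)

variable {Q} [IsManifold I 1 Q]

/-- The vertical lift `T_qQ → T_{(v_q, s)}(TQ × ℝ)`: the derivative of the inclusion of the fibre
`w ↦ (w, s)` at `v_q`, that is, `w ↦ d/dt|₀ (v_q + t w, s)`. -/
def verticalLift (p : TQR I Q) :
    TangentSpace I p.1.proj →L[ℝ] TangentSpace (modelTQR I) p :=
  mfderiv 𝓘(ℝ, E) (modelTQR I)
    (fun w : E => ((⟨p.1.proj, w⟩ : TangentBundle I Q), p.2)) p.1.snd

/-- The canonical tangent structure `S` of `TQ`, extended to `TQ × ℝ`: project a tangent vector to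
`TQ` and then to `Q`, and lift the result vertically. In natural coordinates, `S = ∂/∂u ⊗ dq`. -/
def tangentStructure (p : TQR I Q) :
    TangentSpace (modelTQR I) p →L[ℝ] TangentSpace (modelTQR I) p :=
  (verticalLift I p).comp (mfderiv (modelTQR I) I (fun p' : TQR I Q => p'.1.proj) p)

/-- The Liouville vector field `Δ = u ∂/∂u` on `TQ × ℝ`. -/
def liouville (p : TQR I Q) : TangentSpace (modelTQR I) p :=
  verticalLift I p p.1.snd

/-- The complete lift `X^C` to `TQ × ℝ` of a vector field `X` on `Q`.
In the natural coordinates `(q, u, s)` induced by the preferred chart of `Q` at the base point,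
`X^C = X ∂/∂q + (∂X/∂q · u) ∂/∂u`. The second component of the derivative of the section
`q ↦ (q, X q)` of `TQ`, applied to `u`, is the coordinate derivative `∂X/∂q · u`. -/
def completeLift (X : (q : Q) → TangentSpace I q) (p : TQR I Q) :
    TangentSpace (modelTQR I) p :=
  let dX : E × E :=
    mfderiv I I.tangent (fun q => (⟨q, X q⟩ : TangentBundle I Q)) p.1.proj p.1.snd
  let Xq : E := X p.1.proj
  (((Xq, dX.2), 0) : (E × E) × ℝ)

variable (L : TQR I Q → ℝ)

/-- The Hessian `∂²L/∂u∂u` of `L` with respect to the velocities, at `p = (v_q, s)`: the second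
derivative at `v_q` of the restriction of `L` to the vector space `T_qQ × {s}`. -/
def fibreHessian (p : TQR I Q) : E →L[ℝ] E →L[ℝ] ℝ :=
  fderiv ℝ (fun w : E =>
    fderiv ℝ (fun u : E => L ((⟨p.1.proj, u⟩ : TangentBundle I Q), p.2)) w) p.1.snd

/-- `L` is regular if its Hessian with respect to the velocities is everywhere nondegenerate. -/
def IsRegularLagrangian : Prop :=
  ∀ p : TQR I Q, ∀ w : E, (∀ w' : E, fibreHessian I L p w w' = 0) → w = 0

/-- The differential of a function on `TQ × ℝ`. -/
def differential (f : TQR I Q → ℝ) (p : TQR I Q) : TangentSpace (modelTQR I) p →L[ℝ] ℝ :=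
  mfderiv (modelTQR I) 𝓘(ℝ, ℝ) f p

/-- The Lagrangian 1-form `η_L = ds - dL ∘ S`. -/
def lagrangianForm (p : TQR I Q) : TangentSpace (modelTQR I) p →L[ℝ] ℝ :=
  differential I (fun p' => p'.2) p - (differential I L p).comp (tangentStructure I p)

/-- The Lagrangian energy `E_L = Δ(L) - L`. -/
def energy (p : TQR I Q) : ℝ := differential I L p (liouville I p) - L p

/-- The partial derivative `∂L/∂s`. -/
def partialS (p : TQR I Q) : ℝ := deriv (fun s : ℝ => L (p.1, s)) p.2

/-- `♭_L(X) = i_X dη_L + η_L(X) η_L`, at the point `p`. -/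
def flat (p : TQR I Q) (X Z : TangentSpace (modelTQR I) p) : ℝ :=
  extDerivOneForm (modelTQR I) (lagrangianForm I L) p X Z
    + lagrangianForm I L p X * lagrangianForm I L p Z

/-- `Γ` is the Herglotz vector field of `L`: the smooth vector field on `TQ × ℝ` such that
`♭_L(Γ) = dE_L + (∂L/∂s - E_L) η_L`. -/
structure IsHerglotz (Γ : (p : TQR I Q) → TangentSpace (modelTQR I) p)
    [IsManifold (modelTQR I) 1 (TQR I Q)] : Prop where
  smooth : IsSmoothVectorField (modelTQR I) Γ
  equation : ∀ (p : TQR I Q) (Z : TangentSpace (modelTQR I) p),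
    flat I L p (Γ p) Z =
      differential I (energy I L) p Z + (partialS I L p - energy I L p) * lagrangianForm I L p Z

end Lagrangian

section Action

variable {EG : Type*} [NormedAddCommGroup EG] [NormedSpace ℝ EG] {HG : Type*} [TopologicalSpace HG]
  (IG : ModelWithCorners ℝ EG HG)
  {E : Type*} [NormedAddCommGroup E] [NormedSpace ℝ E] {H : Type*} [TopologicalSpace H]
  (I : ModelWithCorners ℝ E H)
  (G : Type*) [TopologicalSpace G] [ChartedSpace HG G] [Group G]
  (Q : Type*) [TopologicalSpace Q] [ChartedSpace H Q] [MulAction G Q]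

theorem contMDiff_smul_left [ContMDiffSMul IG I ∞ G Q] (g : G) :
    ContMDiff I I ∞ (fun q : Q => g • q) :=
  (contMDiff_smul (I := IG) (I' := I) (n := ∞) (G := G) (M := Q)).comp
    (contMDiff_const.prodMk contMDiff_id)

/-- The lifted action of `G` on `TQ`: `g` acts by the tangent map of `q ↦ g • q`. -/
abbrev liftedAction [ContMDiffSMul IG I ∞ G Q] : MulAction G (TangentBundle I Q) where
  smul g v := tangentMap I I (fun q : Q => g • q) v
  one_smul v := by
    change tangentMap I I (fun q : Q => (1 : G) • q) v = v
    have h : (fun q : Q => (1 : G) • q) = id := by ext q; simp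
    rw [h, tangentMap_id]; rfl
  mul_smul g h v := by
    change tangentMap I I (fun q : Q => (g * h) • q) v =
      tangentMap I I (fun q : Q => g • q) (tangentMap I I (fun q : Q => h • q) v)
    have e : (fun q : Q => (g * h) • q) = (fun q : Q => g • q) ∘ (fun q : Q => h • q) := by
      ext q; simp [mul_smul]
    rw [e]
    exact tangentMap_comp_at (I := I) (I' := I) (I'' := I) v
      ((contMDiff_smul_left IG I G Q g).mdifferentiable (by simp) _)
      ((contMDiff_smul_left IG I G Q h).mdifferentiable (by simp) _)

/-- The orbit space `TQ/G` of the lifted action, with the quotient topology. -/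
abbrev TQmodG [ContMDiffSMul IG I ∞ G Q] : Type _ :=
  Quotient (@MulAction.orbitRel G (TangentBundle I Q) _ (liftedAction IG I G Q))

variable {Q}

/-- The projection `π : TQ → TQ/G`. -/
def projTQ [ContMDiffSMul IG I ∞ G Q] (v : TangentBundle I Q) : TQmodG IG I G Q :=
  Quotient.mk _ v

/-- The projection `TQ × ℝ → TQ/G × ℝ`, `(v_q, s) ↦ ([v_q], s)`. -/
def projTQR [ContMDiffSMul IG I ∞ G Q] (p : TQR I Q) : TQmodG IG I G Q × ℝ :=
  (projTQ IG I G p.1, p.2)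

variable {G}

/-- The induced action of `g` on `TQ × ℝ`, trivial on `ℝ`: `(v_q, s) ↦ (TΦ_g(v_q), s)`. -/
def actTQR (g : G) (p : TQR I Q) : TQR I Q :=
  (tangentMap I I (fun q : Q => g • q) p.1, p.2)

/-- The fundamental vector field `ξ_Q` of `ξ` in the Lie algebra of `G`: `ξ_Q(q)` is the derivative
at the identity of `g ↦ g • q` applied to `ξ`. -/
def fundamentalField (ξ : GroupLieAlgebra IG G) (q : Q) : TangentSpace I q :=
  let ξQ : E := mfderiv IG I (fun g : G => g • q) (1 : G) ξ
  ξQ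

end Action

end ContactReduction

end

open ContactReduction

/-!
Invariance of the Herglotz vector field is a consequence of its uniqueness. For a symmetry `f` of
`L`, the lift of `f` to `TQ × ℝ` preserves `L`, the tangent structure `S` and the Liouville field
`Δ`, hence also `η_L`, `E_L`, `∂L/∂s` and, because `d` commutes with pullbacks
(`extDerivOneForm_pullback`), the map `♭_L`. So the pushforward of `Γ` solves the equation that
defines `Γ`. In natural coordinates regularity of `L` makes `♭_L` injective (`flat_injective`), and
therefore the pushforward of `Γ` is `Γ` (`IsHerglotz.mfderiv_tangentLift`).

The infinitesimal statement is deduced from the global one. If the maps `P g` of a smooth family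
preserve a field `W`, then differentiating the invariance in `g` at a parameter with `P g = id`
shows that `W` commutes with the velocity field of the family (`mlieBracket_eq_zero_of_invariant`):
in a chart both terms of the bracket are the same mixed second derivative. The complete lift of
`ξ_Q` is the velocity field of the lifted action (`completeLift_velocity`), again by symmetry of
second derivatives.

The lifted action on `TQ` is free and proper because the projection `TQ → Q` is equivariant. For a
free action the orbit maps are immersions (`eq_zero_of_mfderiv_smul_eq_zero`), so the inverse
function theorem gives a transversal to the orbit through a given point (`exists_local_slice`), and
properness allows it to be shrunk until it meets each orbit at most once (`exists_slice`).
The slices are the charts of the orbit space. A transition map is the composition of the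
parametrization of one slice with the retraction along the orbits to the other, and so it is smooth
(`isManifold_orbitChartedSpace`). The projection has smooth local sections; with the invariance of
`Γ` they show that `Γ` projects to a unique smooth field (`existsUnique_projected_vectorField`).

Mathlib defines `TangentSpace I x` to be the model space `E` for every `x`. Ascriptions such as
`(mfderiv I I' f x : E →L[ℝ] E')` make use of this in order to compare vectors at points that are
equal but not definitionally so.
-/

noncomputable section

namespace ContactReduction

/-! ### One-forms in charts -/

section OneFormsInCharts

variable {E : Type*} [NormedAddCommGroup E] [NormedSpace ℝ E] {H : Type*} [TopologicalSpace H]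
  (I : ModelWithCorners ℝ E H) {M : Type*} [TopologicalSpace M] [ChartedSpace H M]

/-- The local representative of a 1-form `α` in the preferred chart at `x`. -/
def oneFormInChart (α : (x : M) → TangentSpace I x →L[ℝ] ℝ) (x : M) (y : E) : E →L[ℝ] ℝ :=
  (α ((extChartAt I x).symm y)).comp (mfderivWithin 𝓘(ℝ, E) I (extChartAt I x).symm (Set.range I) y)

/-- Without boundary, `dα` is computed with `fderiv` of the local representative: the chart at `x`
has the identity as derivative at `x`. -/
theorem extDerivOneForm_eq [I.Boundaryless] [IsManifold I 1 M]
    (α : (x : M) → TangentSpace I x →L[ℝ] ℝ) (x : M) (v w : E) :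
    extDerivOneForm I α x v w =
      fderiv ℝ (oneFormInChart I α x) (extChartAt I x x) v w -
        fderiv ℝ (oneFormInChart I α x) (extChartAt I x x) w v := by
  have h (u : E) : (mfderiv I 𝓘(ℝ, E) (extChartAt I x) x : E →L[ℝ] E) u = u := by
    rw [mfderiv_extChartAt_self]; rfl
  rw [← fderivWithin_univ, ← I.range_eq_univ]
  change fderivWithin ℝ (oneFormInChart I α x) (Set.range I) (extChartAt I x x)
      ((mfderiv I 𝓘(ℝ, E) (extChartAt I x) x : E →L[ℝ] E) v)
        ((mfderiv I 𝓘(ℝ, E) (extChartAt I x) x : E →L[ℝ] E) w) -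
      fderivWithin ℝ (oneFormInChart I α x) (Set.range I) (extChartAt I x x)
      ((mfderiv I 𝓘(ℝ, E) (extChartAt I x) x : E →L[ℝ] E) w)
        ((mfderiv I 𝓘(ℝ, E) (extChartAt I x) x : E →L[ℝ] E) v) = _
  rw [h, h]

theorem oneFormInChart_self [I.Boundaryless] [IsManifold I 1 M]
    (α : (x : M) → TangentSpace I x →L[ℝ] ℝ) (x : M) (v : E) :
    oneFormInChart I α x (extChartAt I x x) v = α x v := by
  have h1 : (mfderivWithin 𝓘(ℝ, E) I (extChartAt I x).symm (Set.range I) (extChartAt I x x) :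
      E →L[ℝ] E) v = v := by
    rw [mfderivWithin_range_extChartAt_symm]; rfl
  change (α ((extChartAt I x).symm (extChartAt I x x)) : E →L[ℝ] ℝ)
    ((mfderivWithin 𝓘(ℝ, E) I (extChartAt I x).symm (Set.range I) (extChartAt I x x) :
      E →L[ℝ] E) v) = _
  rw [h1]
  have h2 : ∀ z, z = x → (α z : E →L[ℝ] ℝ) v = (α x : E →L[ℝ] ℝ) v := by rintro _ rfl; rfl
  exact h2 _ (extChartAt_to_inv x)

end OneFormsInCharts

/-! ### Natural coordinates on `TQ × ℝ` -/

section Charts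

variable {E : Type*} [NormedAddCommGroup E] [NormedSpace ℝ E] {H : Type*} [TopologicalSpace H]
  {I : ModelWithCorners ℝ E H} {Q : Type*} [TopologicalSpace Q] [ChartedSpace H Q]
  [IsManifold I 1 Q]

/-- A point `((q, u), s)` lies in the range of a natural chart if and only if `q` lies in the range
of the chart of `Q`. -/
theorem mem_extChartAt_TQR_target {p : TQR I Q} {y : (E × E) × ℝ} :
    y ∈ (extChartAt (modelTQR I) p).target ↔ y.1.1 ∈ (extChartAt I p.1.proj).target := by
  rw [extChartAt_prod, FiberBundle.extChartAt]
  have h1 := fun h : y.1.1 ∈ (extChartAt I p.1.proj).target =>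
    (extChartAt I p.1.proj).map_target h
  rw [extChartAt_source] at h1
  have h2 : y.2 ∈ (extChartAt 𝓘(ℝ, ℝ) p.2).target := by
    rw [extChartAt_model_space_eq_id]; trivial
  rw [PartialEquiv.prod_target, Set.mem_prod, and_iff_left h2, PartialEquiv.trans_target,
    PartialEquiv.prod_target, PartialEquiv.prod_symm]
  simp only [PartialEquiv.refl_target, Set.mem_inter_iff, Set.mem_prod, Set.mem_univ, and_true,
    Set.mem_preimage, PartialEquiv.prod_coe, TangentBundle.trivializationAt_target]
  exact and_iff_left_of_imp h1

theorem extChartAt_TQR_symm_apply {p : TQR I Q} {y : (E × E) × ℝ}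
    (hy : y ∈ (extChartAt (modelTQR I) p).target) :
    (extChartAt (modelTQR I) p).symm y =
      (⟨(extChartAt I p.1.proj).symm y.1.1,
        (trivializationAt E (TangentSpace I) p.1.proj).symmL ℝ
          ((extChartAt I p.1.proj).symm y.1.1) y.1.2⟩, y.2) := by
  have hy' := (mem_extChartAt_TQR_target).1 hy
  have hb : (extChartAt I p.1.proj).symm y.1.1 ∈
      (trivializationAt E (TangentSpace I) p.1.proj).baseSet := by
    rw [TangentBundle.trivializationAt_baseSet, ← extChartAt_source I]
    exact (extChartAt I p.1.proj).map_target hy'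
  have := (trivializationAt E (TangentSpace I) p.1.proj).mk_symm hb y.1.2
  rw [Bundle.Trivialization.symmL_apply _ hb, this, extChartAt_prod, FiberBundle.extChartAt]
  refine Prod.ext rfl ?_
  change (extChartAt 𝓘(ℝ, ℝ) p.2).symm y.2 = y.2
  rw [extChartAt_model_space_eq_id]; rfl

/-- The trivialization of `TQ` over a chart of `Q` is the derivative of the chart. -/
theorem trivializationAt_snd_eq_mfderiv (q : Q) (z : TangentBundle I Q)
    (hz : z.proj ∈ (chartAt H q).source) :
    (trivializationAt E (TangentSpace I) q z).2 =
      (mfderiv I 𝓘(ℝ, E) (extChartAt I q) z.proj : E →L[ℝ] E) z.snd := by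
  have hb : z.proj ∈ (trivializationAt E (TangentSpace I) q).baseSet := by
    rw [TangentBundle.trivializationAt_baseSet]; exact hz
  have key : (trivializationAt E (TangentSpace I) q).continuousLinearMapAt ℝ z.proj
      z.snd = (trivializationAt E (TangentSpace I) q z).2 := by
    rw [Bundle.Trivialization.continuousLinearMapAt_apply,
      Bundle.Trivialization.linearMapAt_apply, if_pos hb]
  exact key.symm.trans
    (DFunLike.congr_fun (TangentBundle.continuousLinearMapAt_trivializationAt hz) z.snd)

theorem extChartAt_tangent_apply (v z : TangentBundle I Q)
    (hz : z.proj ∈ (chartAt H v.proj).source) :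
    extChartAt I.tangent v z = (extChartAt I v.proj z.proj,
      (mfderiv I 𝓘(ℝ, E) (extChartAt I v.proj) z.proj : E →L[ℝ] E) z.snd) := by
  rw [← trivializationAt_snd_eq_mfderiv v.proj z hz, FiberBundle.extChartAt]
  rfl

theorem extChartAt_TQR_apply (p : TQR I Q) (z : TQR I Q)
    (hz : z.1.proj ∈ (chartAt H p.1.proj).source) :
    extChartAt (modelTQR I) p z = ((extChartAt I p.1.proj z.1.proj,
      (mfderiv I 𝓘(ℝ, E) (extChartAt I p.1.proj) z.1.proj : E →L[ℝ] E) z.1.snd), z.2) := by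
  rw [← extChartAt_tangent_apply p.1 z.1 hz, extChartAt_prod]
  refine Prod.ext rfl ?_
  change extChartAt 𝓘(ℝ, ℝ) p.2 z.2 = z.2
  rw [extChartAt_model_space_eq_id]; rfl

/-- The inverse of the trivialization of `TQ` over a chart of `Q` is the derivative of the inverse
chart. -/
theorem symmL_trivializationAt_apply {q : Q} {a : E} (ha : a ∈ (extChartAt I q).target) (w : E) :
    ((trivializationAt E (TangentSpace I) q).symmL ℝ ((extChartAt I q).symm a) w : E) =
      (mfderivWithin 𝓘(ℝ, E) I (extChartAt I q).symm (Set.range I) a : E →L[ℝ] E) w := by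
  have hx : (extChartAt I q).symm a ∈ (chartAt H q).source := by
    rw [← extChartAt_source I]; exact (extChartAt I q).map_target ha
  have h := TangentBundle.symmL_trivializationAt (I := I) hx
  have h2 : ∀ a', a' = a →
      (mfderivWithin 𝓘(ℝ, E) I (extChartAt I q).symm (Set.range I) a' : E →L[ℝ] E) w =
      (mfderivWithin 𝓘(ℝ, E) I (extChartAt I q).symm (Set.range I) a : E →L[ℝ] E) w := by
    rintro _ rfl; rfl
  exact (DFunLike.congr_fun h w).trans (h2 _ ((extChartAt I q).right_inv ha))

end Charts

/-! ### Chain rule and charts without boundary -/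

section Boundaryless

variable {E : Type*} [NormedAddCommGroup E] [NormedSpace ℝ E] {H : Type*} [TopologicalSpace H]
  {I : ModelWithCorners ℝ E H} {M : Type*} [TopologicalSpace M] [ChartedSpace H M] [I.Boundaryless]

omit [I.Boundaryless] in
/-- The chain rule for a map `h` that is, near `x`, a composition. All derivatives are maps between
the model spaces, so that `h x` need not be `g (f x)` definitionally. -/
theorem mfderiv_apply_mfderiv_of_eventuallyEq
    {E₁ : Type*} [NormedAddCommGroup E₁] [NormedSpace ℝ E₁] {H₁ : Type*} [TopologicalSpace H₁]
    {I₁ : ModelWithCorners ℝ E₁ H₁} {M₁ : Type*} [TopologicalSpace M₁] [ChartedSpace H₁ M₁]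
    {E₂ : Type*} [NormedAddCommGroup E₂] [NormedSpace ℝ E₂] {H₂ : Type*} [TopologicalSpace H₂]
    {I₂ : ModelWithCorners ℝ E₂ H₂} {M₂ : Type*} [TopologicalSpace M₂] [ChartedSpace H₂ M₂]
    {f : M → M₁} {g : M₁ → M₂} {h : M → M₂} {x : M}
    (hg : MDifferentiableAt I₁ I₂ g (f x)) (hf : MDifferentiableAt I I₁ f x)
    (e : ∀ᶠ y in nhds x, g (f y) = h y) (v : E) :
    (mfderiv I₁ I₂ g (f x) : E₁ →L[ℝ] E₂) ((mfderiv I I₁ f x : E →L[ℝ] E₁) v) =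
      (mfderiv I I₂ h x : E →L[ℝ] E₂) v := by
  have h1 := mfderiv_comp_apply (x := x) (I' := I₁) hg hf v
  have h2 : mfderiv I I₂ (g ∘ f) x = (mfderiv I I₂ h x : E →L[ℝ] E₂) :=
    Filter.EventuallyEq.mfderiv_eq e
  exact h1.symm.trans (DFunLike.congr_fun h2 v)

theorem contMDiffAt_extChartAt_symm {n : ℕ∞ω} [IsManifold I n M] {x : M} {y : E}
    (hy : y ∈ (extChartAt I x).target) : ContMDiffAt 𝓘(ℝ, E) I n (extChartAt I x).symm y :=
  (contMDiffOn_extChartAt_symm x).contMDiffAt ((isOpen_extChartAt_target x).mem_nhds hy)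

theorem oneFormInChart_apply (α : (x : M) → TangentSpace I x →L[ℝ] ℝ) (x : M) (y : E) (v : E) :
    oneFormInChart I α x y v =
      α ((extChartAt I x).symm y) (mfderiv 𝓘(ℝ, E) I (extChartAt I x).symm y v) := by
  rw [← mfderivWithin_univ, ← I.range_eq_univ]
  rfl

end Boundaryless

/-! ### The form `η_L` in natural coordinates -/

section Lagrangian

variable {E : Type*} [NormedAddCommGroup E] [NormedSpace ℝ E] {H : Type*} [TopologicalSpace H]
  {I : ModelWithCorners ℝ E H} {Q : Type*} [TopologicalSpace Q] [ChartedSpace H Q]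
  [IsManifold I ∞ Q]

/-- In the trivialization at `q`, the inclusion of the fibre over `q` is linear. -/
theorem contMDiff_fibreInclusion (q : Q) (s : ℝ) :
    ContMDiff 𝓘(ℝ, E) (modelTQR I) ∞
      (fun w : E => ((⟨q, w⟩ : TangentBundle I Q), s)) := by
  refine ContMDiff.prodMk (fun w => ?_) contMDiff_const
  refine (Bundle.contMDiffAt_totalSpace (IM := 𝓘(ℝ, E)) (IB := I) (F := E) (E := TangentSpace I)
    (f := fun w : E => (⟨q, w⟩ : TangentBundle I Q))).2 ⟨contMDiffAt_const, ?_⟩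
  exact (ContinuousLinearMap.contDiff (fderivWithin ℝ ((chartAt H q).extend I ∘
    ((chartAt H q).extend I).symm) (Set.range I) ((chartAt H q).extend I q))).contMDiff.contMDiffAt

variable {L : TQR I Q → ℝ}

theorem differential_verticalLift (hL : ContMDiff (modelTQR I) 𝓘(ℝ, ℝ) ∞ L) (x : TQR I Q)
    (w : E) : differential I L x (verticalLift I x w) =
      fderiv ℝ (fun w : E => L ((⟨x.1.proj, w⟩ : TangentBundle I Q), x.2)) x.1.snd w := by
  have h1 : MDifferentiableAt 𝓘(ℝ, E) (modelTQR I)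
      (fun w : E => ((⟨x.1.proj, w⟩ : TangentBundle I Q), x.2)) x.1.snd :=
    (contMDiff_fibreInclusion x.1.proj x.2).mdifferentiable (by simp) _
  have h2 : MDifferentiableAt (modelTQR I) 𝓘(ℝ, ℝ) L
      ((⟨x.1.proj, x.1.snd⟩ : TangentBundle I Q), x.2) := hL.mdifferentiable (by simp) _
  have h3 := (mfderiv_comp_apply (x := (x.1.snd : E)) (I' := modelTQR I)
     (f := (fun w : E => ((⟨x.1.proj, w⟩ : TangentBundle I Q), x.2))) h2 h1 w).symm
  exact h3.trans (DFunLike.congr_fun (mfderiv_eq_fderiv (x := (x.1.snd : E))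
    (f := fun w : E => L ((⟨x.1.proj, w⟩ : TangentBundle I Q), x.2))) w)

theorem contDiffOn_chart (hL : ContMDiff (modelTQR I) 𝓘(ℝ, ℝ) ∞ L) (p : TQR I Q) :
    ContDiffOn ℝ ∞ (L ∘ (extChartAt (modelTQR I) p).symm) (extChartAt (modelTQR I) p).target := by
  rw [← contMDiffOn_iff_contDiffOn]
  exact hL.comp_contMDiffOn (contMDiffOn_extChartAt_symm p)

variable [I.Boundaryless]

/-- In natural coordinates `(q, u, s)`, `η_L = ds - (∂L/∂u) dq`. -/
theorem oneFormInChart_lagrangianForm (hL : ContMDiff (modelTQR I) 𝓘(ℝ, ℝ) ∞ L) {p : TQR I Q}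
    {y : (E × E) × ℝ} (hy : y ∈ (extChartAt (modelTQR I) p).target) (Y : (E × E) × ℝ) :
    oneFormInChart (modelTQR I) (lagrangianForm I L) p y Y =
      Y.2 - fderiv ℝ (L ∘ (extChartAt (modelTQR I) p).symm) y ((0, Y.1.1), 0) := by
  have hopen := isOpen_extChartAt_target (I := modelTQR I) p
  have hd : MDifferentiableAt 𝓘(ℝ, (E × E) × ℝ) (modelTQR I) (extChartAt (modelTQR I) p).symm y :=
    (contMDiffAt_extChartAt_symm (n := ∞) hy).mdifferentiableAt (by simp)
  have ha := mem_extChartAt_TQR_target.1 hy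
  set κ := extChartAt I p.1.proj with hκ
  set T := (trivializationAt E (TangentSpace I) p.1.proj).symmL ℝ (κ.symm y.1.1) with hT
  rw [oneFormInChart_apply]
  set x := (extChartAt (modelTQR I) p).symm y with hx
  set V := mfderiv 𝓘(ℝ, (E × E) × ℝ) (modelTQR I) (extChartAt (modelTQR I) p).symm y Y with hV
  have hmem : ∀ᶠ z in nhds y, z ∈ (extChartAt (modelTQR I) p).target := hopen.mem_nhds hy
  -- `ds (V)`, the base component of `V`, and `dL` of its vertical lift
  have h1 : differential I (fun p' : TQR I Q => p'.2) x V = Y.2 := by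
    refine (mfderiv_apply_mfderiv_of_eventuallyEq (M := (E × E) × ℝ) (I₁ := modelTQR I)
      (h := Prod.snd) mdifferentiableAt_snd hd ?_ Y).trans ?_
    · filter_upwards [hmem] with z hz
      rw [extChartAt_TQR_symm_apply hz]
    · rw [mfderiv_eq_fderiv, fderiv_snd]; rfl
  have h2 : (mfderiv (modelTQR I) I (fun p' : TQR I Q => p'.1.proj) x V : E) =
      T Y.1.1 := by
    refine (mfderiv_apply_mfderiv_of_eventuallyEq (M := (E × E) × ℝ) (I₁ := modelTQR I)
      (h := fun z => κ.symm z.1.1) ?_ hd ?_ Y).trans ?_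
    · exact ((Bundle.contMDiff_proj (TangentSpace I) (n := ∞)).comp
        contMDiff_fst).mdifferentiableAt (by simp)
    · filter_upwards [hmem] with z hz
      rw [extChartAt_TQR_symm_apply hz]
    · have hκd : MDifferentiableAt 𝓘(ℝ, E) I κ.symm y.1.1 :=
        (contMDiffAt_extChartAt_symm (n := ∞) ha).mdifferentiableAt (by simp)
      have h := mfderiv_apply_mfderiv_of_eventuallyEq (M := (E × E) × ℝ) (I := 𝓘(ℝ, (E × E) × ℝ))
        (x := y) (I₁ := 𝓘(ℝ, E)) (f := fun z : (E × E) × ℝ => z.1.1) (h := fun z => κ.symm z.1.1)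
        hκd
        (differentiable_fst.comp differentiable_fst).differentiableAt.mdifferentiableAt
        (by simp) Y
      have h' : (mfderiv 𝓘(ℝ, (E × E) × ℝ) 𝓘(ℝ, E) (fun z : (E × E) × ℝ => z.1.1) y :
          ((E × E) × ℝ) →L[ℝ] E) Y = Y.1.1 := by
        rw [mfderiv_eq_fderiv]
        have : HasFDerivAt (fun z : (E × E) × ℝ => z.1.1)
          ((ContinuousLinearMap.fst ℝ E E).comp (ContinuousLinearMap.fst ℝ (E × E) ℝ)) y :=
          (hasFDerivAt_fst).comp y hasFDerivAt_fst
        rw [this.fderiv]; rfl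
      have h'' := symmL_trivializationAt_apply ha Y.1.1
      rw [I.range_eq_univ, mfderivWithin_univ] at h''
      exact h.symm.trans ((congrArg _ h').trans h''.symm)
  have h3 : fderiv ℝ (L ∘ (extChartAt (modelTQR I) p).symm) y ((0, Y.1.1), 0) =
      fderiv ℝ (fun w : E => L ((⟨x.1.proj, w⟩ : TangentBundle I Q), x.2)) x.1.snd
        (T Y.1.1) := by
    have hLd : DifferentiableAt ℝ (L ∘ (extChartAt (modelTQR I) p).symm) y :=
      ((contDiffOn_chart hL p).contDiffAt (hopen.mem_nhds hy)).differentiableAt (by simp)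
    have hi : HasFDerivAt (fun b : E => (((y.1.1, b), y.2) : (E × E) × ℝ))
        (((0 : E →L[ℝ] E).prod (ContinuousLinearMap.id ℝ E)).prod 0) y.1.2 :=
      ((hasFDerivAt_const _ _).prodMk (hasFDerivAt_id _)).prodMk (hasFDerivAt_const _ _)
    have hc := (hLd.hasFDerivAt (x := ((y.1.1, y.1.2), y.2))).comp y.1.2 hi
    set T' : E →L[ℝ] E := T
    have hL' : DifferentiableAt ℝ (fun w : E => L ((⟨κ.symm y.1.1, w⟩ : TangentBundle I Q), y.2))
        (T' y.1.2) :=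
      (hL.comp (contMDiff_fibreInclusion (κ.symm y.1.1) y.2)).contDiff.differentiable (by simp) _
    have hc' := hL'.hasFDerivAt.comp y.1.2 T'.hasFDerivAt
    have he : ((L ∘ (extChartAt (modelTQR I) p).symm) ∘
        fun b : E => (((y.1.1, b), y.2) : (E × E) × ℝ)) =
        (fun w : E => L ((⟨κ.symm y.1.1, w⟩ : TangentBundle I Q), y.2)) ∘ T' := by
      funext b
      exact congrArg L (extChartAt_TQR_symm_apply (p := p) (y := ((y.1.1, b), y.2))
        (mem_extChartAt_TQR_target.2 ha))
    rw [he] at hc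
    have h4 := DFunLike.congr_fun (hc.unique hc') Y.1.1
    have hgen : ∀ x' : TQR I Q, x' = x →
      fderiv ℝ (fun w : E => L ((⟨x'.1.proj, w⟩ : TangentBundle I Q), x'.2)) x'.1.snd (T' Y.1.1)
      = fderiv ℝ (fun w : E => L ((⟨x.1.proj, w⟩ : TangentBundle I Q), x.2)) x.1.snd
        (T' Y.1.1) := by rintro _ rfl; rfl
    exact h4.trans (hgen _ (extChartAt_TQR_symm_apply hy).symm)
  have h5 := differential_verticalLift hL x
    (mfderiv (modelTQR I) I (fun p' : TQR I Q => p'.1.proj) x V)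
  have h6 : lagrangianForm I L x V = differential I (fun p' : TQR I Q => p'.2) x V -
    differential I L x (verticalLift I x
      (mfderiv (modelTQR I) I (fun p' : TQR I Q => p'.1.proj) x V)) := rfl
  rw [h6, h1, h5, h3]
  exact congrArg (fun z : E => Y.2 -
    fderiv ℝ (fun w : E => L ((⟨x.1.proj, w⟩ : TangentBundle I Q), x.2)) x.1.snd z) h2

end Lagrangian

/-! ### The map `♭_L` in natural coordinates -/

section Flat

variable {E : Type*} [NormedAddCommGroup E] [NormedSpace ℝ E] {H : Type*} [TopologicalSpace H]
  {I : ModelWithCorners ℝ E H} {Q : Type*} [TopologicalSpace Q] [ChartedSpace H Q]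
  [IsManifold I ∞ Q] [I.Boundaryless] {L : TQR I Q → ℝ}

/-- The local representative of `L` in the preferred chart at `p`. -/
def chartRep (L : TQR I Q → ℝ) (p : TQR I Q) : (E × E) × ℝ → ℝ :=
  L ∘ (extChartAt (modelTQR I) p).symm

theorem contDiffAt_chartRep (hL : ContMDiff (modelTQR I) 𝓘(ℝ, ℝ) ∞ L) {p : TQR I Q}
    {y : (E × E) × ℝ} (hy : y ∈ (extChartAt (modelTQR I) p).target) :
    ContDiffAt ℝ ∞ (chartRep L p) y :=
  (contDiffOn_chart hL p).contDiffAt ((isOpen_extChartAt_target p).mem_nhds hy)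

/-- The tangent structure `S` in natural coordinates, `(a, b, c) ↦ (0, a, 0)`. -/
def chartTangentStructure (E : Type*) [NormedAddCommGroup E] [NormedSpace ℝ E] :
    ((E × E) × ℝ) →L[ℝ] ((E × E) × ℝ) :=
  (((0 : ((E × E) × ℝ) →L[ℝ] E).prod
    ((ContinuousLinearMap.fst ℝ E E).comp (ContinuousLinearMap.fst ℝ (E × E) ℝ))).prod 0)

theorem oneFormInChart_lagrangianForm_eq (hL : ContMDiff (modelTQR I) 𝓘(ℝ, ℝ) ∞ L) {p : TQR I Q}
    {y : (E × E) × ℝ} (hy : y ∈ (extChartAt (modelTQR I) p).target) :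
    oneFormInChart (modelTQR I) (lagrangianForm I L) p y =
      ContinuousLinearMap.snd ℝ (E × E) ℝ -
        (fderiv ℝ (chartRep L p) y).comp (chartTangentStructure E) := by
  refine ContinuousLinearMap.ext fun Y => ?_
  exact oneFormInChart_lagrangianForm hL hy Y

theorem hasFDerivAt_oneFormInChart_lagrangianForm (hL : ContMDiff (modelTQR I) 𝓘(ℝ, ℝ) ∞ L)
    {p : TQR I Q} {y : (E × E) × ℝ} (hy : y ∈ (extChartAt (modelTQR I) p).target) :
    HasFDerivAt (oneFormInChart (modelTQR I) (lagrangianForm I L) p)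
      (-(((ContinuousLinearMap.compL ℝ ((E × E) × ℝ) ((E × E) × ℝ) ℝ).flip
        (chartTangentStructure E)).comp (fderiv ℝ (fderiv ℝ (chartRep L p)) y))) y := by
  have h1 : DifferentiableAt ℝ (fderiv ℝ (chartRep L p)) y :=
    ((contDiffAt_chartRep hL hy).fderiv_right (m := 1) (by norm_cast)).differentiableAt (by simp)
  have h2 := (((ContinuousLinearMap.compL ℝ ((E × E) × ℝ) ((E × E) × ℝ) ℝ).flip
        (chartTangentStructure E)).hasFDerivAt.comp y h1.hasFDerivAt).const_sub
          (ContinuousLinearMap.snd ℝ (E × E) ℝ)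
  refine h2.congr_of_eventuallyEq ?_
  filter_upwards [(isOpen_extChartAt_target (I := modelTQR I) p).mem_nhds hy] with z hz
  exact oneFormInChart_lagrangianForm_eq hL hz

/-- The map `♭_L` at `p`, in natural coordinates. -/
theorem flat_eq (hL : ContMDiff (modelTQR I) 𝓘(ℝ, ℝ) ∞ L) (p : TQR I Q) (X Z : (E × E) × ℝ) :
    flat I L p X Z =
      fderiv ℝ (fderiv ℝ (chartRep L p)) (extChartAt (modelTQR I) p p) Z ((0, X.1.1), 0) -
      fderiv ℝ (fderiv ℝ (chartRep L p)) (extChartAt (modelTQR I) p p) X ((0, Z.1.1), 0) +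
      (X.2 - fderiv ℝ (chartRep L p) (extChartAt (modelTQR I) p p) ((0, X.1.1), 0)) *
      (Z.2 - fderiv ℝ (chartRep L p) (extChartAt (modelTQR I) p p) ((0, Z.1.1), 0)) := by
  have hp := mem_extChartAt_target (I := modelTQR I) p
  have h1 := extDerivOneForm_eq (modelTQR I) (lagrangianForm I L) p X Z
  rw [(hasFDerivAt_oneFormInChart_lagrangianForm hL hp).fderiv] at h1
  have h2 (Y : (E × E) × ℝ) : lagrangianForm I L p Y =
      Y.2 - fderiv ℝ (chartRep L p) (extChartAt (modelTQR I) p p) ((0, Y.1.1), 0) := by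
    exact (oneFormInChart_self (modelTQR I) (lagrangianForm I L) p Y).symm.trans
      (oneFormInChart_lagrangianForm hL hp Y)
  have h3 : flat I L p X Z = extDerivOneForm (modelTQR I) (lagrangianForm I L) p X Z
    + lagrangianForm I L p X * lagrangianForm I L p Z := rfl
  rw [h3, h1, h2, h2]
  congr 1
  change -(fderiv ℝ (fderiv ℝ (chartRep L p)) (extChartAt (modelTQR I) p p) X ((0, Z.1.1), 0))
    - -(fderiv ℝ (fderiv ℝ (chartRep L p)) (extChartAt (modelTQR I) p p) Z ((0, X.1.1), 0)) = _
  ring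

omit [I.Boundaryless] in
/-- The natural chart at `p` is the identity on the fibre through `p`. -/
theorem extChartAt_TQR_fibre (p : TQR I Q) (u : E) :
    extChartAt (modelTQR I) p ((⟨p.1.proj, u⟩ : TangentBundle I Q), p.2) =
      ((extChartAt I p.1.proj p.1.proj, u), p.2) := by
  have : (mfderiv I 𝓘(ℝ, E) (extChartAt I p.1.proj) p.1.proj : E →L[ℝ] E) u = u := by
    rw [mfderiv_extChartAt_self]; rfl
  exact (extChartAt_TQR_apply p ((⟨p.1.proj, u⟩ : TangentBundle I Q), p.2)
    (mem_chart_source H p.1.proj)).trans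
    (congrArg (fun v : E => ((extChartAt I p.1.proj p.1.proj, v), p.2)) this)

omit [I.Boundaryless] in
theorem chartRep_fibre (p : TQR I Q) (u : E) :
    chartRep L p ((extChartAt I p.1.proj p.1.proj, u), p.2) =
      L ((⟨p.1.proj, u⟩ : TangentBundle I Q), p.2) := by
  refine congrArg L ((congrArg _ (extChartAt_TQR_fibre p u).symm).trans
    ((extChartAt (modelTQR I) p).left_inv ?_))
  rw [extChartAt_source, prodChartedSpace_chartAt]
  refine ⟨?_, ?_⟩
  · exact (TangentBundle.mem_chart_source_iff _ _).2 (mem_chart_source H p.1.proj)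
  · exact mem_chart_source ℝ p.2

omit [I.Boundaryless] in
theorem extChartAt_TQR_self (p : TQR I Q) :
    extChartAt (modelTQR I) p p = ((extChartAt I p.1.proj p.1.proj, p.1.snd), p.2) :=
  extChartAt_TQR_fibre p p.1.snd

omit [I.Boundaryless] [IsManifold I ∞ Q] [ChartedSpace H Q] [TopologicalSpace Q]
  [TopologicalSpace H] in
/-- The second derivative of the restriction of `ℓ` to a fibre. -/
theorem fderiv_fderiv_comp_fibre {ℓ : (E × E) × ℝ → ℝ} {a : E} {c : ℝ}
    (hℓ : ∀ u, ContDiffAt ℝ ∞ ℓ ((a, u), c)) (u w w' : E) :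
    fderiv ℝ (fun w : E => fderiv ℝ (fun u : E => ℓ ((a, u), c)) w) u w w' =
      fderiv ℝ (fderiv ℝ ℓ) ((a, u), c) ((0, w), 0) ((0, w'), 0) := by
  set J : E →L[ℝ] (E × E) × ℝ := ((0 : E →L[ℝ] E).prod (ContinuousLinearMap.id ℝ E)).prod 0
  have hi (u : E) : HasFDerivAt (fun b : E => (((a, b), c) : (E × E) × ℝ)) J u :=
    ((hasFDerivAt_const _ _).prodMk (hasFDerivAt_id _)).prodMk (hasFDerivAt_const _ _)
  have h1 (u : E) : fderiv ℝ (fun u => ℓ ((a, u), c)) u = (fderiv ℝ ℓ ((a, u), c)).comp J :=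
    (HasFDerivAt.comp (g := ℓ) (f := fun b : E => (((a, b), c) : (E × E) × ℝ)) u
      ((hℓ u).differentiableAt (by simp)).hasFDerivAt (hi u)).fderiv
  have h2 : DifferentiableAt ℝ (fderiv ℝ ℓ) ((a, u), c) :=
    ((hℓ u).fderiv_right (m := 1) (by norm_cast)).differentiableAt (by simp)
  have h3 := ((ContinuousLinearMap.compL ℝ E ((E × E) × ℝ) ℝ).flip J).hasFDerivAt.comp
    u (HasFDerivAt.comp (g := fderiv ℝ ℓ) (f := fun b : E => (((a, b), c) : (E × E) × ℝ)) u
      h2.hasFDerivAt (hi u))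
  rw [funext h1]
  exact DFunLike.congr_fun (DFunLike.congr_fun h3.fderiv w) w'

/-- The fibre Hessian is the matrix `∂²L/∂u∂u` in natural coordinates. -/
theorem fibreHessian_eq (hL : ContMDiff (modelTQR I) 𝓘(ℝ, ℝ) ∞ L) (p : TQR I Q) (w w' : E) :
    fibreHessian I L p w w' =
      fderiv ℝ (fderiv ℝ (chartRep L p)) (extChartAt (modelTQR I) p p) ((0, w), 0)
        ((0, w'), 0) := by
  have hfun : (fun u : E => L ((⟨p.1.proj, u⟩ : TangentBundle I Q), p.2)) =
      fun u => chartRep L p ((extChartAt I p.1.proj p.1.proj, u), p.2) :=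
    funext fun u => (chartRep_fibre p u).symm
  have h4 : fibreHessian I L p = fderiv ℝ (fun w : E => fderiv ℝ
    (fun u : E => L ((⟨p.1.proj, u⟩ : TangentBundle I Q), p.2)) w) (p.1.snd : E) := rfl
  rw [h4, hfun, extChartAt_TQR_self]
  exact fderiv_fderiv_comp_fibre (fun b => contDiffAt_chartRep hL
    (mem_extChartAt_TQR_target.2 (mem_extChartAt_target (I := I) p.1.proj))) _ w w'

/-- Regularity makes `♭_L` injective: evaluating on `∂/∂u`, then on `∂/∂s`, then on `∂/∂q` kills
the `∂/∂q`-, the `∂/∂s`- and the `∂/∂u`-component of a vector in the kernel, in this order. -/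
theorem flat_injective (hL : ContMDiff (modelTQR I) 𝓘(ℝ, ℝ) ∞ L) (hreg : IsRegularLagrangian I L)
    (p : TQR I Q) (X X' : (E × E) × ℝ) (h : ∀ Z : (E × E) × ℝ, flat I L p X Z = flat I L p X' Z) :
    X = X' := by
  simp only [flat_eq hL] at h
  have hsymm : IsSymmSndFDerivAt ℝ (chartRep L p) (extChartAt (modelTQR I) p p) :=
    (contDiffAt_chartRep hL (mem_extChartAt_target p)).isSymmSndFDerivAt (by simp; norm_cast)
  have hreg' : ∀ w : E, (∀ w' : E, fderiv ℝ (fderiv ℝ (chartRep L p))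
      (extChartAt (modelTQR I) p p) ((0, w), 0) ((0, w'), 0) = 0) → w = 0 := by
    intro w hw
    exact hreg p w fun w' => (fibreHessian_eq hL p w w').trans (hw w')
  generalize extChartAt (modelTQR I) p p = y at h hreg' hsymm
  generalize hD : fderiv ℝ (chartRep L p) y = D at h
  generalize hB : fderiv ℝ (fderiv ℝ (chartRep L p)) y = B at h hreg'
  replace hsymm : ∀ v w, B v w = B w v := by rw [← hB]; exact hsymm
  obtain ⟨⟨a, b⟩, c⟩ := X
  obtain ⟨⟨a', b'⟩, c'⟩ := X'
  have hz : ((((0 : E), (0 : E)), (0 : ℝ))) = 0 := rfl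
  -- evaluation on `∂/∂u`
  have ea : a = a' := by
    rw [← sub_eq_zero]
    refine hreg' _ fun w => ?_
    have := h ((0, w), 0)
    have hs : (((0 : E), a - a'), (0 : ℝ)) = ((0, a), 0) - ((0, a'), 0) := by simp
    simp only [hz, map_zero, sub_zero, mul_zero, add_zero] at this
    rw [hsymm, hs, map_sub, this, sub_self]
  subst ea
  -- evaluation on `∂/∂s`
  have ec : c = c' := by
    have := h ((0, 0), 1)
    simp only [hz, map_zero, sub_zero, mul_one] at this
    linarith
  subst ec
  -- evaluation on `∂/∂q`
  have eb : b = b' := by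
    rw [← sub_eq_zero]
    refine hreg' _ fun w => ?_
    have := h ((w, 0), 0)
    have hs : (((0 : E), b - b'), (0 : ℝ)) = ((a, b), c) - ((a, b'), c) := by simp
    rw [hs, map_sub, sub_apply]
    simp only at this
    linarith
  rw [eb]

end Flat

/-! ### Naturality of the exterior derivative -/

section Pullback

/-- The exterior derivative commutes with pullback, for 1-forms on normed spaces. The terms with the
second derivative of `ψ` cancel by symmetry. -/
theorem fderiv_sub_fderiv_swap_pullback {F F' : Type*} [NormedAddCommGroup F] [NormedSpace ℝ F]
    [NormedAddCommGroup F'] [NormedSpace ℝ F'] {α : F → F →L[ℝ] ℝ} {β : F' → F' →L[ℝ] ℝ}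
    {ψ : F → F'} {y : F} (hψ : ContDiffAt ℝ 2 ψ y) (hβ : DifferentiableAt ℝ β (ψ y))
    (h : ∀ᶠ z in nhds y, α z = (β (ψ z)).comp (fderiv ℝ ψ z)) (v w : F) :
    fderiv ℝ α y v w - fderiv ℝ α y w v =
      fderiv ℝ β (ψ y) (fderiv ℝ ψ y v) (fderiv ℝ ψ y w) -
        fderiv ℝ β (ψ y) (fderiv ℝ ψ y w) (fderiv ℝ ψ y v) := by
  have hs := hψ.isSymmSndFDerivAt (by simp) v w
  have h1 : HasFDerivAt ψ (fderiv ℝ ψ y) y := (hψ.differentiableAt (by simp)).hasFDerivAt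
  have h2 : HasFDerivAt (fderiv ℝ ψ) (fderiv ℝ (fderiv ℝ ψ) y) y :=
    ((hψ.fderiv_right (m := 1) (by norm_num)).differentiableAt (by simp)).hasFDerivAt
  have h3 := (hβ.hasFDerivAt.comp y h1).clm_comp h2
  have h4 : fderiv ℝ α y = _ := (h3.congr_of_eventuallyEq h).fderiv
  rw [h4]
  simp only [add_apply, ContinuousLinearMap.comp_apply, ContinuousLinearMap.compL_apply,
    ContinuousLinearMap.flip_apply, Function.comp_apply]
  rw [hs]
  ring

variable {E : Type*} [NormedAddCommGroup E] [NormedSpace ℝ E] {H : Type*} [TopologicalSpace H]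
  {I : ModelWithCorners ℝ E H} {M : Type*} [TopologicalSpace M] [ChartedSpace H M] [I.Boundaryless]
  {E' : Type*} [NormedAddCommGroup E'] [NormedSpace ℝ E'] {H' : Type*} [TopologicalSpace H']
  {I' : ModelWithCorners ℝ E' H'} {M' : Type*} [TopologicalSpace M'] [ChartedSpace H' M']
  [I'.Boundaryless]

omit [I'.Boundaryless] in
theorem mfderiv_eq_fderiv_writtenInExtChartAt {f : M → M'} {x : M} {x' : M'}
    (hf : MDifferentiableAt I I' f x) (hx : f x = x') :
    (mfderiv I I' f x : E →L[ℝ] E') =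
      fderiv ℝ (extChartAt I' x' ∘ f ∘ (extChartAt I x).symm) (extChartAt I x x) := by
  subst hx
  rw [← fderivWithin_univ, ← I.range_eq_univ]
  exact hf.mfderiv

variable [IsManifold I ∞ M] [IsManifold I' ∞ M']

omit [I'.Boundaryless] in
/-- A smooth map is smooth in charts, at all points of the chart domains. -/
theorem contDiffAt_writtenInExtChartAt {f : M → M'} (hf : ContMDiff I I' ∞ f) {x : M} {x' : M'}
    {y : E} (hy : y ∈ (extChartAt I x).target)
    (hy' : f ((extChartAt I x).symm y) ∈ (extChartAt I' x').source) :
    ContDiffAt ℝ ∞ (extChartAt I' x' ∘ f ∘ (extChartAt I x).symm) y := by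
  rw [← contMDiffAt_iff_contDiffAt]
  exact (contMDiffAt_extChartAt' (by rwa [extChartAt_source] at hy')).comp y
    (hf.contMDiffAt.comp y (contMDiffAt_extChartAt_symm hy))

/-- The exterior derivative commutes with pullback: if `f^*β = α`, then `f^*dβ = dα`. -/
theorem extDerivOneForm_pullback {f : M → M'} (hf : ContMDiff I I' ∞ f)
    {α : (x : M) → TangentSpace I x →L[ℝ] ℝ} {β : (x : M') → TangentSpace I' x →L[ℝ] ℝ}
    (h : ∀ x v, β (f x) (mfderiv I I' f x v) = α x v) {x : M}
    (hβ : DifferentiableAt ℝ (oneFormInChart I' β (f x)) (extChartAt I' (f x) (f x)))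
    (v w : TangentSpace I x) :
    extDerivOneForm I' β (f x) (mfderiv I I' f x v) (mfderiv I I' f x w) =
      extDerivOneForm I α x v w := by
  have h1 := extDerivOneForm_eq I α x v w
  have h2 := extDerivOneForm_eq I' β (f x) (mfderiv I I' f x v) (mfderiv I I' f x w)
  have hfd : MDifferentiable I I' f := hf.mdifferentiable (by simp)
  have h3 := mfderiv_eq_fderiv_writtenInExtChartAt (hfd x) rfl
  refine h2.trans (Eq.trans ?_ h1.symm)
  set φ := extChartAt I x
  set φ' := extChartAt I' (f x)
  set ψ := φ' ∘ f ∘ φ.symm with hψ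
  have hinv : φ.symm (φ x) = x := extChartAt_to_inv x
  have hψx : ψ (φ x) = φ' (f x) := congrArg (φ' ∘ f) hinv
  have hcont : ContinuousAt (f ∘ φ.symm) (φ x) :=
    hf.continuous.continuousAt.comp (continuousAt_extChartAt_symm x)
  have hev : ∀ᶠ z in nhds (φ x), f (φ.symm z) ∈ φ'.source := by
    refine hcont.eventually_mem ?_
    rw [Function.comp_apply, hinv]
    exact extChartAt_source_mem_nhds (f x)
  have hev2 : ∀ᶠ z in nhds (φ x), z ∈ φ.target :=
    (isOpen_extChartAt_target x).mem_nhds (mem_extChartAt_target x)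
  have key := fderiv_sub_fderiv_swap_pullback (α := oneFormInChart I α x)
    (β := oneFormInChart I' β (f x)) (ψ := ψ) (y := φ x)
    ((contDiffAt_writtenInExtChartAt hf (mem_extChartAt_target x)
      hev.self_of_nhds).of_le (by norm_cast)) (by rw [hψx]; exact hβ) ?_ v w
  · rw [key, hψx, ← h3]
    rfl
  · filter_upwards [hev.eventually_nhds, hev2] with z hz hz2
    refine ContinuousLinearMap.ext fun u => ?_
    rw [oneFormInChart_apply, ← h]
    refine Eq.trans ?_ (oneFormInChart_apply β (f x) (ψ z) (fderiv ℝ ψ z u)).symm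
    have hφd : MDifferentiableAt 𝓘(ℝ, E) I φ.symm z :=
      (contMDiffAt_extChartAt_symm (n := ∞) hz2).mdifferentiableAt (by simp)
    have hzt : ψ z ∈ φ'.target := φ'.map_source hz.self_of_nhds
    have hφd' : MDifferentiableAt 𝓘(ℝ, E') I' φ'.symm (ψ z) :=
      (contMDiffAt_extChartAt_symm (n := ∞) hzt).mdifferentiableAt (by simp)
    have hψd : MDifferentiableAt 𝓘(ℝ, E) 𝓘(ℝ, E') ψ z :=
      (contDiffAt_writtenInExtChartAt hf hz2
        hz.self_of_nhds).differentiableAt (by simp) |>.mdifferentiableAt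
    -- both composites of the square `φ'⁻¹ ∘ ψ = f ∘ φ⁻¹` have the same derivative
    have e1 := mfderiv_apply_mfderiv_of_eventuallyEq (h := f ∘ φ.symm) (hfd (φ.symm z)) hφd
      (by simp) u
    have e2 := mfderiv_apply_mfderiv_of_eventuallyEq (h := f ∘ φ.symm) hφd' hψd
      (by filter_upwards [hz] with z' hz'; exact φ'.left_inv hz') u
    rw [mfderiv_eq_fderiv] at e2
    have e3 : φ'.symm (ψ z) = f (φ.symm z) := φ'.left_inv hz.self_of_nhds
    have e4 : ∀ x', f (φ.symm z) = x' → ∀ a b : E', a = b →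
      (β (f (φ.symm z)) : E' →L[ℝ] ℝ) a = (β x' : E' →L[ℝ] ℝ) b := by
      rintro _ rfl _ _ rfl; rfl
    exact e4 _ e3.symm _ _ (e1.trans e2.symm)

end Pullback

/-! ### Symmetries of the Lagrangian -/

section TangentLift

variable {E : Type*} [NormedAddCommGroup E] [NormedSpace ℝ E] {H : Type*} [TopologicalSpace H]
  {I : ModelWithCorners ℝ E H} {Q : Type*} [TopologicalSpace Q] [ChartedSpace H Q]
  [IsManifold I ∞ Q] {L : TQR I Q → ℝ} {f : Q → Q}

variable (I) in
/-- The lift `(v, s) ↦ (Tf(v), s)` to `TQ × ℝ` of a map `f : Q → Q`. -/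
def tangentLift (f : Q → Q) (p : TQR I Q) : TQR I Q := (tangentMap I I f p.1, p.2)

theorem contMDiff_tangentLift (hf : ContMDiff I I ∞ f) :
    ContMDiff (modelTQR I) (modelTQR I) ∞ (tangentLift I f) :=
  ((hf.contMDiff_tangentMap (m := ∞) (by simp)).comp contMDiff_fst).prodMk contMDiff_snd

/-- On a fibre the lift of `f` is linear, so its derivative there is `Tf` itself. -/
theorem mfderiv_tangentLift_verticalLift (hf : ContMDiff I I ∞ f) (p : TQR I Q)
    (w : TangentSpace I p.1.proj) :
    mfderiv (modelTQR I) (modelTQR I) (tangentLift I f) p (verticalLift I p w) =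
      verticalLift I (tangentLift I f p) (mfderiv I I f p.1.proj w) := by
  set T : E →L[ℝ] E := mfderiv I I f p.1.proj with hT
  have h1 := mfderiv_apply_mfderiv_of_eventuallyEq (x := (p.1.snd : E)) (I := 𝓘(ℝ, E))
    (f := fun w : E => ((⟨p.1.proj, w⟩ : TangentBundle I Q), p.2)) (I₁ := modelTQR I)
    (h := fun w : E => tangentLift I f ((⟨p.1.proj, w⟩ : TangentBundle I Q), p.2))
    ((contMDiff_tangentLift hf).mdifferentiable (by simp) _)
    ((contMDiff_fibreInclusion p.1.proj p.2).mdifferentiable (by simp) _) (by simp) w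
  have h2 := mfderiv_apply_mfderiv_of_eventuallyEq (x := (p.1.snd : E)) (I := 𝓘(ℝ, E))
    (I₁ := 𝓘(ℝ, E)) (f := T) (I₂ := modelTQR I)
    (g := fun w : E => ((⟨f p.1.proj, w⟩ : TangentBundle I Q), p.2))
    (h := fun w : E => tangentLift I f ((⟨p.1.proj, w⟩ : TangentBundle I Q), p.2))
    ((contMDiff_fibreInclusion (f p.1.proj) p.2).mdifferentiable (by simp) _)
    T.differentiableAt.mdifferentiableAt (Filter.Eventually.of_forall fun _ => rfl) w
  have h3 (u v : E) : (mfderiv 𝓘(ℝ, E) 𝓘(ℝ, E) T u : E →L[ℝ] E) v = T v := by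
    rw [mfderiv_eq_fderiv, T.fderiv]; rfl
  exact h1.trans (h2.symm.trans (congrArg (verticalLift I (tangentLift I f p)) (h3 _ _)))

theorem mfderiv_proj_mfderiv_tangentLift (hf : ContMDiff I I ∞ f) (p : TQR I Q)
    (V : TangentSpace (modelTQR I) p) :
    (mfderiv (modelTQR I) I (fun p' : TQR I Q => p'.1.proj) (tangentLift I f p)
      (mfderiv (modelTQR I) (modelTQR I) (tangentLift I f) p V) : E) =
      (mfderiv I I f p.1.proj : E →L[ℝ] E)
        (mfderiv (modelTQR I) I (fun p' : TQR I Q => p'.1.proj) p V) := by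
  have hproj : MDifferentiable (modelTQR I) I (fun p' : TQR I Q => p'.1.proj) :=
    ((Bundle.contMDiff_proj (TangentSpace I) (n := ∞)).comp
        contMDiff_fst).mdifferentiable (by simp)
  exact (mfderiv_apply_mfderiv_of_eventuallyEq (h := fun p' : TQR I Q => f p'.1.proj)
    (hproj _) ((contMDiff_tangentLift hf).mdifferentiable (by simp) p)
    (Filter.Eventually.of_forall fun _ => rfl) V).trans
    (mfderiv_apply_mfderiv_of_eventuallyEq (h := fun p' : TQR I Q => f p'.1.proj)
    (hf.mdifferentiable (by simp) _) (hproj p)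
    (Filter.Eventually.of_forall fun _ => rfl) V).symm

theorem mfderiv_tangentLift_tangentStructure (hf : ContMDiff I I ∞ f) (p : TQR I Q)
    (V : TangentSpace (modelTQR I) p) :
    mfderiv (modelTQR I) (modelTQR I) (tangentLift I f) p (tangentStructure I p V) =
      tangentStructure I (tangentLift I f p)
        (mfderiv (modelTQR I) (modelTQR I) (tangentLift I f) p V) :=
  (mfderiv_tangentLift_verticalLift hf p _).trans
    (congrArg (verticalLift I (tangentLift I f p))
      (mfderiv_proj_mfderiv_tangentLift hf p V).symm)

theorem mfderiv_tangentLift_liouville (hf : ContMDiff I I ∞ f) (p : TQR I Q) :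
    mfderiv (modelTQR I) (modelTQR I) (tangentLift I f) p (liouville I p) =
      liouville I (tangentLift I f p) :=
  mfderiv_tangentLift_verticalLift hf p _

theorem differential_tangentLift (hf : ContMDiff I I ∞ f)
    (hL : ContMDiff (modelTQR I) 𝓘(ℝ, ℝ) ∞ L) (hinv : ∀ p, L (tangentLift I f p) = L p)
    (p : TQR I Q) (V : TangentSpace (modelTQR I) p) :
    differential I L (tangentLift I f p)
      (mfderiv (modelTQR I) (modelTQR I) (tangentLift I f) p V) = differential I L p V :=
  mfderiv_apply_mfderiv_of_eventuallyEq (h := L)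
    (hL.mdifferentiable (by simp) _) ((contMDiff_tangentLift hf).mdifferentiable (by simp) p)
    (Filter.Eventually.of_forall hinv) V

theorem lagrangianForm_tangentLift (hf : ContMDiff I I ∞ f)
    (hL : ContMDiff (modelTQR I) 𝓘(ℝ, ℝ) ∞ L) (hinv : ∀ p, L (tangentLift I f p) = L p)
    (p : TQR I Q) (V : TangentSpace (modelTQR I) p) :
    lagrangianForm I L (tangentLift I f p)
      (mfderiv (modelTQR I) (modelTQR I) (tangentLift I f) p V) = lagrangianForm I L p V := by
  have h1 : ∀ p V, lagrangianForm I L p V = differential I (fun p' : TQR I Q => p'.2) p V -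
    differential I L p (tangentStructure I p V) := fun _ _ => rfl
  rw [h1, h1, ← mfderiv_tangentLift_tangentStructure hf, differential_tangentLift hf hL hinv,
    differential_tangentLift hf contMDiff_snd fun _ => rfl]

theorem energy_tangentLift (hf : ContMDiff I I ∞ f)
    (hL : ContMDiff (modelTQR I) 𝓘(ℝ, ℝ) ∞ L) (hinv : ∀ p, L (tangentLift I f p) = L p)
    (p : TQR I Q) : energy I L (tangentLift I f p) = energy I L p := by
  rw [energy, energy, ← mfderiv_tangentLift_liouville hf, differential_tangentLift hf hL hinv,
    hinv]

omit [IsManifold I ∞ Q] in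
theorem partialS_tangentLift [IsManifold I 1 Q] (hinv : ∀ p, L (tangentLift I f p) = L p)
    (p : TQR I Q) :
    partialS I L (tangentLift I f p) = partialS I L p := by
  have : (fun s : ℝ => L ((tangentLift I f p).1, s)) = fun s => L (p.1, s) :=
    funext fun s => hinv (p.1, s)
  rw [partialS, this]; rfl

omit [IsManifold I ∞ Q] in
theorem tangentLift_comp [IsManifold I 1 Q] {f' : Q → Q} (hf : MDifferentiable I I f)
    (hf' : MDifferentiable I I f')
    (h : Function.LeftInverse f' f) (p : TQR I Q) :
    tangentLift I f' (tangentLift I f p) = p := by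
  refine Prod.ext ?_ rfl
  have h1 := tangentMap_comp_at (I := I) (I' := I) (I'' := I) p.1 (hf' _) (hf _)
  have h2 : f' ∘ f = id := funext h
  rw [h2, tangentMap_id] at h1
  exact h1.symm

/-- The derivatives of the lifts of `f` and of a left inverse of `f` are inverse to each other. -/
theorem mfderiv_tangentLift_comp {f' : Q → Q} (hf : ContMDiff I I ∞ f) (hf' : ContMDiff I I ∞ f')
    (h : Function.LeftInverse f' f) (p : TQR I Q) (V : (E × E) × ℝ) :
    (mfderiv (modelTQR I) (modelTQR I) (tangentLift I f') (tangentLift I f p) :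
      ((E × E) × ℝ) →L[ℝ] ((E × E) × ℝ)) ((mfderiv (modelTQR I) (modelTQR I) (tangentLift I f) p :
      ((E × E) × ℝ) →L[ℝ] ((E × E) × ℝ)) V) = V := by
  refine (mfderiv_apply_mfderiv_of_eventuallyEq (h := id)
    ((contMDiff_tangentLift hf').mdifferentiable (by simp) _)
    ((contMDiff_tangentLift hf).mdifferentiable (by simp) p)
    (Filter.Eventually.of_forall (tangentLift_comp (hf.mdifferentiable (by simp))
      (hf'.mdifferentiable (by simp)) h)) V).trans ?_
  rw [mfderiv_id]; rfl

theorem mfderiv_tangentLift_surjective {f' : Q → Q} (hf : ContMDiff I I ∞ f)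
    (hf' : ContMDiff I I ∞ f') (h : Function.LeftInverse f' f) (h' : Function.RightInverse f' f)
    (p : TQR I Q) (Z : (E × E) × ℝ) : ∃ V : (E × E) × ℝ,
      (mfderiv (modelTQR I) (modelTQR I) (tangentLift I f) p :
        ((E × E) × ℝ) →L[ℝ] ((E × E) × ℝ)) V = Z := by
  have h2 := mfderiv_tangentLift_comp hf' hf h' (tangentLift I f p) Z
  rw [tangentLift_comp (hf.mdifferentiable (by simp)) (hf'.mdifferentiable (by simp)) h] at h2
  exact ⟨_, h2⟩

/-- `dE_L` is invariant. If `E_L` is not differentiable at a point, then it is not differentiable at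
the image point either, and both differentials are zero by convention; so smoothness of `E_L` is
not needed. -/
theorem differential_energy_tangentLift {f' : Q → Q} (hf : ContMDiff I I ∞ f)
    (hf' : ContMDiff I I ∞ f') (h : Function.LeftInverse f' f) (h' : Function.RightInverse f' f)
    (hL : ContMDiff (modelTQR I) 𝓘(ℝ, ℝ) ∞ L) (hinv : ∀ p, L (tangentLift I f p) = L p)
    (p : TQR I Q) (V : TangentSpace (modelTQR I) p) :
    differential I (energy I L) (tangentLift I f p)
      (mfderiv (modelTQR I) (modelTQR I) (tangentLift I f) p V) =
      differential I (energy I L) p V := by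
  have hE := energy_tangentLift hf hL hinv
  by_cases hd : MDifferentiableAt (modelTQR I) 𝓘(ℝ, ℝ) (energy I L) (tangentLift I f p)
  · exact mfderiv_apply_mfderiv_of_eventuallyEq (h := energy I L)
      hd ((contMDiff_tangentLift hf).mdifferentiable (by simp) p)
      (Filter.Eventually.of_forall hE) V
  · have hd' : ¬ MDifferentiableAt (modelTQR I) 𝓘(ℝ, ℝ) (energy I L) p := by
      intro h1
      refine hd ?_
      have h2 : energy I L = energy I L ∘ tangentLift I f' := by
        funext q
        have := hE (tangentLift I f' q)
        rw [tangentLift_comp (hf'.mdifferentiable (by simp)) (hf.mdifferentiable (by simp)) h']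
          at this
        exact this
      rw [h2]
      refine MDifferentiableAt.comp (I' := modelTQR I) _ ?_
        ((contMDiff_tangentLift hf').mdifferentiable (by simp) _)
      rwa [tangentLift_comp (hf.mdifferentiable (by simp)) (hf'.mdifferentiable (by simp)) h]
    rw [differential, differential, mfderiv_zero_of_not_mdifferentiableAt hd,
      mfderiv_zero_of_not_mdifferentiableAt hd']
    rfl

variable [I.Boundaryless]

theorem flat_tangentLift (hf : ContMDiff I I ∞ f)
    (hL : ContMDiff (modelTQR I) 𝓘(ℝ, ℝ) ∞ L) (hinv : ∀ p, L (tangentLift I f p) = L p)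
    (p : TQR I Q) (X Z : TangentSpace (modelTQR I) p) :
    flat I L (tangentLift I f p) (mfderiv (modelTQR I) (modelTQR I) (tangentLift I f) p X)
      (mfderiv (modelTQR I) (modelTQR I) (tangentLift I f) p Z) = flat I L p X Z := by
  have h1 : ∀ p X Z, flat I L p X Z = extDerivOneForm (modelTQR I) (lagrangianForm I L) p X Z
    + lagrangianForm I L p X * lagrangianForm I L p Z := fun _ _ _ => rfl
  rw [h1, h1, lagrangianForm_tangentLift hf hL hinv, lagrangianForm_tangentLift hf hL hinv,
    extDerivOneForm_pullback (contMDiff_tangentLift hf) (lagrangianForm_tangentLift hf hL hinv)]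
  exact (hasFDerivAt_oneFormInChart_lagrangianForm hL (mem_extChartAt_target _)).differentiableAt

/-- A symmetry of the Lagrangian is a symmetry of its Herglotz vector field: the pushforward of `Γ`
solves the defining equation of `Γ`, whose solution is unique. -/
theorem IsHerglotz.mfderiv_tangentLift {Γ : (p : TQR I Q) → TangentSpace (modelTQR I) p}
    (hΓ : IsHerglotz I L Γ) {f' : Q → Q} (hf : ContMDiff I I ∞ f)
    (hf' : ContMDiff I I ∞ f') (h : Function.LeftInverse f' f) (h' : Function.RightInverse f' f)
    (hL : ContMDiff (modelTQR I) 𝓘(ℝ, ℝ) ∞ L) (hreg : IsRegularLagrangian I L)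
    (hinv : ∀ p, L (tangentLift I f p) = L p) (p : TQR I Q) :
    mfderiv (modelTQR I) (modelTQR I) (tangentLift I f) p (Γ p) = Γ (tangentLift I f p) := by
  refine flat_injective hL hreg (tangentLift I f p) _ _ fun Z => ?_
  obtain ⟨V, rfl⟩ := mfderiv_tangentLift_surjective hf hf' h h' p Z
  refine (flat_tangentLift hf hL hinv p (Γ p) V).trans ((hΓ.equation p V).trans ?_)
  refine Eq.trans ?_ (hΓ.equation (tangentLift I f p) _).symm
  exact congrArg₂ (· + ·) (differential_energy_tangentLift hf hf' h h' hL hinv p V).symm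
    (congrArg₂ (· * ·) (congrArg₂ (· - ·) (partialS_tangentLift hinv p).symm
      (energy_tangentLift hf hL hinv p).symm) (lagrangianForm_tangentLift hf hL hinv p V).symm)

end TangentLift

/-! ### Invariant vector fields and brackets -/

section Bracket

/-- The infinitesimal form of invariance on normed spaces: if the maps `f (a, ·)` preserve `W` to
first order at `y`, then `W` commutes with the field `V` of velocities of `f` in the parameter `a`.
Both terms of the bracket are mixed second derivatives of `f`. -/
theorem lieBracket_eq_zero_of_invariant {A F : Type*} [NormedAddCommGroup A] [NormedSpace ℝ A]
    [NormedAddCommGroup F] [NormedSpace ℝ F] {f : A × F → F} {V W : F → F} {a : A} {y : F} {ξ : A}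
    (hf : ContDiffAt ℝ 2 f (a, y)) (hfa : f (a, y) = y) (hW : DifferentiableAt ℝ W y)
    (hV : ∀ᶠ z in nhds y, V z = fderiv ℝ f (a, z) (ξ, 0))
    (hinv : ∀ᶠ b in nhds a, fderiv ℝ f (b, y) (0, W y) = W (f (b, y))) :
    VectorField.lieBracket ℝ V W y = 0 := by
  have hs := hf.isSymmSndFDerivAt (by simp) (ξ, 0) (0, W y)
  have h1 : HasFDerivAt f (fderiv ℝ f (a, y)) (a, y) := (hf.differentiableAt (by simp)).hasFDerivAt
  have h2 : HasFDerivAt (fderiv ℝ f) (fderiv ℝ (fderiv ℝ f) (a, y)) (a, y) :=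
    ((hf.fderiv_right (m := 1) (by norm_num)).differentiableAt (by simp)).hasFDerivAt
  have hl : HasFDerivAt (fun b : A => (b, y)) (ContinuousLinearMap.inl ℝ A F) a :=
    hasFDerivAt_prodMk_left a y
  have hr : HasFDerivAt (fun z : F => (a, z)) (ContinuousLinearMap.inr ℝ A F) y :=
    hasFDerivAt_prodMk_right a y
  have hVd : HasFDerivAt V _ y :=
    (((ContinuousLinearMap.apply ℝ F ((ξ, 0) : A × F)).hasFDerivAt.comp y
      (HasFDerivAt.comp (f := fun z : F => (a, z)) y h2 hr))).congr_of_eventuallyEq hV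
  have h3 : HasFDerivAt (fun b => fderiv ℝ f (b, y) (0, W y)) _ a :=
    ((ContinuousLinearMap.apply ℝ F ((0, W y) : A × F)).hasFDerivAt.comp a
      (HasFDerivAt.comp (f := fun b : A => (b, y)) a h2 hl))
  rw [← hfa] at hW
  have h4 : HasFDerivAt (fun b => fderiv ℝ f (b, y) (0, W y)) _ a :=
    (HasFDerivAt.comp (g := W) (f := fun b => f (b, y)) a hW.hasFDerivAt
      (HasFDerivAt.comp (g := f) (f := fun b : A => (b, y)) a h1 hl)).congr_of_eventuallyEq hinv
  have h5 := DFunLike.congr_fun (h4.unique h3) ξ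
  rw [hfa] at h5
  rw [VectorField.lieBracket, hVd.fderiv, hV.self_of_nhds]
  simp only [ContinuousLinearMap.comp_apply, ContinuousLinearMap.inl_apply,
    ContinuousLinearMap.inr_apply, ContinuousLinearMap.apply_apply] at h5 ⊢
  rw [h5, hs, sub_self]

variable {A : Type*} [NormedAddCommGroup A] [NormedSpace ℝ A] {HA : Type*} [TopologicalSpace HA]
  {IA : ModelWithCorners ℝ A HA} [IA.Boundaryless] {G : Type*} [TopologicalSpace G]
  [ChartedSpace HA G] [IsManifold IA ∞ G]
  {E : Type*} [NormedAddCommGroup E] [NormedSpace ℝ E] {H : Type*} [TopologicalSpace H]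
  {I : ModelWithCorners ℝ E H} {M : Type*} [TopologicalSpace M] [ChartedSpace H M] [I.Boundaryless]
  [IsManifold I ∞ M]

variable (IA I) in
/-- A family of maps `P : G → M → M` written in charts of `G` and of `M`. -/
def familyInCharts (P : G → M → M) (g : G) (x : M) (z : A × E) : E :=
  extChartAt I x (P ((extChartAt IA g).symm z.1) ((extChartAt I x).symm z.2))

theorem contDiffAt_familyInCharts {P : G → M → M}
    (hP : ContMDiff (IA.prod I) I ∞ (fun z : G × M => P z.1 z.2)) {g : G} {x : M} {z : A × E}
    (hz1 : z.1 ∈ (extChartAt IA g).target) (hz2 : z.2 ∈ (extChartAt I x).target)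
    (hz : P ((extChartAt IA g).symm z.1) ((extChartAt I x).symm z.2) ∈ (extChartAt I x).source) :
    ContDiffAt ℝ ∞ (familyInCharts IA I P g x) z := by
  rw [← contMDiffAt_iff_contDiffAt]
  have h1 : ContMDiffAt 𝓘(ℝ, A × E) IA ∞ (fun z : A × E => (extChartAt IA g).symm z.1) z :=
    (contMDiffAt_extChartAt_symm hz1).comp z contDiffAt_fst.contMDiffAt
  have h2 : ContMDiffAt 𝓘(ℝ, A × E) I ∞ (fun z : A × E => (extChartAt I x).symm z.2) z :=
    (contMDiffAt_extChartAt_symm hz2).comp z contDiffAt_snd.contMDiffAt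
  have h3 : ContMDiffAt 𝓘(ℝ, A × E) I ∞ (fun z : A × E => P ((extChartAt IA g).symm z.1)
    ((extChartAt I x).symm z.2)) z := hP.contMDiffAt.comp z (h1.prodMk h2)
  exact (contMDiffAt_extChartAt' (by rwa [extChartAt_source] at hz)).comp z h3

/-- The velocity, in the parameter, of a family of maps written in charts. -/
theorem fderiv_familyInCharts_inl {P : G → M → M}
    (hP : ContMDiff (IA.prod I) I ∞ (fun z : G × M => P z.1 z.2)) {g : G} (hg : ∀ x, P g x = x)
    {x : M} {y : E} (hy : y ∈ (extChartAt I x).target) (ξ : A) :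
    fderiv ℝ (familyInCharts IA I P g x) (extChartAt IA g g, y) (ξ, 0) =
      (mfderiv I 𝓘(ℝ, E) (extChartAt I x) ((extChartAt I x).symm y) : E →L[ℝ] E)
        ((mfderiv IA I (fun g => P g ((extChartAt I x).symm y)) g : A →L[ℝ] E) ξ) := by
  set x' := (extChartAt I x).symm y with hx'
  have hx's : x' ∈ (extChartAt I x).source := (extChartAt I x).map_target hy
  have hgg : (extChartAt IA g).symm (extChartAt IA g g) = g := extChartAt_to_inv g
  have hPs : P ((extChartAt IA g).symm (extChartAt IA g g)) x' ∈ (extChartAt I x).source := by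
    rw [hgg, hg]; exact hx's
  have hPg : ContMDiff IA I ∞ (fun g => P g x') := hP.comp (contMDiff_id.prodMk contMDiff_const)
  have hfd : DifferentiableAt ℝ (familyInCharts IA I P g x) (extChartAt IA g g, y) :=
    (contDiffAt_familyInCharts hP (mem_extChartAt_target g) hy hPs).differentiableAt (by simp)
  have h1 := (HasFDerivAt.comp (f := fun b : A => (b, y)) (extChartAt IA g g) hfd.hasFDerivAt
    (hasFDerivAt_prodMk_left (extChartAt IA g g) y)).fderiv
  have hφ : MDifferentiableAt I 𝓘(ℝ, E) (extChartAt I x) (P g x') := by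
    rw [hg]; exact mdifferentiableAt_extChartAt (by rwa [extChartAt_source] at hx's)
  have hd : MDifferentiableAt IA 𝓘(ℝ, E) (fun g => extChartAt I x (P g x')) g :=
    hφ.comp (I' := I) g (hPg.mdifferentiable (by simp) g)
  have h2 := mfderiv_apply_mfderiv_of_eventuallyEq (h := fun g => extChartAt I x (P g x')) hφ
    (hPg.mdifferentiable (by simp) g) (by simp) ξ
  have h3 := mfderiv_eq_fderiv_writtenInExtChartAt (I' := 𝓘(ℝ, E)) hd rfl
  have h4 : (mfderiv I 𝓘(ℝ, E) (extChartAt I x) (P g x') : E →L[ℝ] E) =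
    (mfderiv I 𝓘(ℝ, E) (extChartAt I x) x' : E →L[ℝ] E) := by
    rw [hg]
  rw [← h4]
  refine Eq.trans ?_ h2.symm
  refine Eq.trans ?_ (DFunLike.congr_fun h3 ξ).symm
  exact (DFunLike.congr_fun h1 ξ).symm

/-- The spatial derivative of a family of maps written in charts. -/
theorem fderiv_familyInCharts_inr {P : G → M → M}
    (hP : ContMDiff (IA.prod I) I ∞ (fun z : G × M => P z.1 z.2)) {g : G} {x : M} {a : A} {y : E}
    (ha : a ∈ (extChartAt IA g).target) (hy : y ∈ (extChartAt I x).target)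
    (hPs : P ((extChartAt IA g).symm a) ((extChartAt I x).symm y) ∈ (extChartAt I x).source)
    (v : E) :
    fderiv ℝ (familyInCharts IA I P g x) (a, y)
      (0, (mfderiv I 𝓘(ℝ, E) (extChartAt I x) ((extChartAt I x).symm y) : E →L[ℝ] E) v) =
      (mfderiv I 𝓘(ℝ, E) (extChartAt I x)
        (P ((extChartAt IA g).symm a) ((extChartAt I x).symm y)) : E →L[ℝ] E)
        ((mfderiv I I (P ((extChartAt IA g).symm a)) ((extChartAt I x).symm y) : E →L[ℝ] E) v) := by
  set x' := (extChartAt I x).symm y with hx'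
  set g' := (extChartAt IA g).symm a with hg'
  have hx's : x' ∈ (extChartAt I x).source := (extChartAt I x).map_target hy
  have hPg : ContMDiff I I ∞ (P g') := hP.comp (contMDiff_const.prodMk contMDiff_id)
  have hfd : DifferentiableAt ℝ (familyInCharts IA I P g x) (a, y) :=
    (contDiffAt_familyInCharts hP ha hy hPs).differentiableAt (by simp)
  have h1 := (HasFDerivAt.comp (f := fun z : E => (a, z)) y hfd.hasFDerivAt
    (hasFDerivAt_prodMk_right a y))
  have hφ : MDifferentiableAt I 𝓘(ℝ, E) (extChartAt I x) (P g' x') :=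
    mdifferentiableAt_extChartAt (by rwa [extChartAt_source] at hPs)
  have hφ' : MDifferentiableAt I 𝓘(ℝ, E) (extChartAt I x) x' :=
    mdifferentiableAt_extChartAt (by rwa [extChartAt_source] at hx's)
  have h2 := mfderiv_apply_mfderiv_of_eventuallyEq (h := fun z => extChartAt I x (P g' z)) hφ
    (hPg.mdifferentiable (by simp) x') (by simp) v
  have hyx : extChartAt I x x' = y := (extChartAt I x).right_inv hy
  have h5 : MDifferentiableAt 𝓘(ℝ, E) 𝓘(ℝ, E) (fun z => familyInCharts IA I P g x (a, z))
      (extChartAt I x x') := by rw [hyx]; exact h1.differentiableAt.mdifferentiableAt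
  have h3 := mfderiv_apply_mfderiv_of_eventuallyEq (h := fun z => extChartAt I x (P g' z)) h5 hφ'
    (by
      filter_upwards [extChartAt_source_mem_nhds' hx's] with z hz
      exact congrArg (fun u => extChartAt I x (P g' u)) ((extChartAt I x).left_inv hz)) v
  rw [hyx, mfderiv_eq_fderiv] at h3
  exact (DFunLike.congr_fun h1.fderiv _).symm.trans (h3.trans h2.symm)

end Bracket

/-! ### Velocity fields of families of maps -/

section BracketManifold

variable {A : Type*} [NormedAddCommGroup A] [NormedSpace ℝ A] {HA : Type*} [TopologicalSpace HA]
  {IA : ModelWithCorners ℝ A HA} [IA.Boundaryless] {G : Type*} [TopologicalSpace G]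
  [ChartedSpace HA G] [IsManifold IA ∞ G]
  {E : Type*} [NormedAddCommGroup E] [NormedSpace ℝ E] {H : Type*} [TopologicalSpace H]
  {I : ModelWithCorners ℝ E H} {M : Type*} [TopologicalSpace M] [ChartedSpace H M] [I.Boundaryless]
  [IsManifold I ∞ M]

omit [I.Boundaryless] in
/-- The local representative of a vector field in a chart. -/
theorem mpullbackWithin_extChartAt_symm (V : (x : M) → TangentSpace I x) {x : M} {y : E}
    (hy : y ∈ (extChartAt I x).target) :
    (VectorField.mpullbackWithin 𝓘(ℝ, E) I (extChartAt I x).symm V (Set.range I) y : E) =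
      (mfderiv I 𝓘(ℝ, E) (extChartAt I x) ((extChartAt I x).symm y) : E →L[ℝ] E)
        (V ((extChartAt I x).symm y)) := by
  have h := ContinuousLinearMap.inverse_eq
    (mfderivWithin_extChartAt_symm_comp_mfderiv_extChartAt (I := I) hy)
    (mfderiv_extChartAt_comp_mfderivWithin_extChartAt_symm (I := I) hy)
  exact DFunLike.congr_fun h (V ((extChartAt I x).symm y))

/-- If all maps `P g` preserve `W`, then `W` commutes with the velocity field of `P` at a parameter
where `P` is the identity. -/
theorem mlieBracket_eq_zero_of_invariant [CompleteSpace E] {P : G → M → M}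
    (hP : ContMDiff (IA.prod I) I ∞ (fun z : G × M => P z.1 z.2)) {g : G} (hg : ∀ x, P g x = x)
    (ξ : A) {V W : (x : M) → TangentSpace I x}
    (hV : ∀ x, (V x : E) = (mfderiv IA I (fun g => P g x) g : A →L[ℝ] E) ξ)
    (hW : IsSmoothVectorField I W)
    (hinv : ∀ g x, mfderiv I I (P g) x (W x) = W (P g x)) :
    VectorField.mlieBracket I V W = 0 := by
  funext x
  rw [← VectorField.mlieBracketWithin_univ, VectorField.mlieBracketWithin_apply]
  rw [Set.preimage_univ, Set.univ_inter, I.range_eq_univ]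
  have hyt := mem_extChartAt_target (I := I) x
  have hat := mem_extChartAt_target (I := IA) g
  have hgg : (extChartAt IA g).symm (extChartAt IA g g) = g := extChartAt_to_inv g
  have hxx : (extChartAt I x).symm (extChartAt I x x) = x := extChartAt_to_inv x
  have hPs : P ((extChartAt IA g).symm (extChartAt IA g g))
      ((extChartAt I x).symm (extChartAt I x x)) ∈ (extChartAt I x).source := by
    rw [hgg, hg, hxx]; exact mem_extChartAt_source x
  have key : VectorField.lieBracket ℝ
      (VectorField.mpullbackWithin 𝓘(ℝ, E) I (extChartAt I x).symm V Set.univ)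
      (VectorField.mpullbackWithin 𝓘(ℝ, E) I (extChartAt I x).symm W Set.univ)
      (extChartAt I x x) = 0 := by
    refine lieBracket_eq_zero_of_invariant (f := familyInCharts IA I P g x) (ξ := ξ)
      (a := extChartAt IA g g)
      ((contDiffAt_familyInCharts hP hat hyt hPs).of_le (by norm_cast)) ?_ ?_ ?_ ?_
    · rw [familyInCharts, hgg, hg, hxx]
    · have h1 : MDifferentiableWithinAt I I.tangent (fun x ↦ (⟨x, W x⟩ : TangentBundle I M))
        Set.univ x := (hW.mdifferentiable (by simp) x).mdifferentiableWithinAt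
      have h2 := h1.differentiableWithinAt_mpullbackWithin_vectorField
      rw [Set.preimage_univ, Set.univ_inter, I.range_eq_univ] at h2
      exact differentiableWithinAt_univ.1 h2
    · filter_upwards [(isOpen_extChartAt_target (I := I) x).mem_nhds hyt] with z hz
      rw [fderiv_familyInCharts_inl hP hg hz, ← I.range_eq_univ]
      exact (mpullbackWithin_extChartAt_symm V hz).trans (congrArg _ (hV _))
    · have hcont : ContinuousAt (fun a => P ((extChartAt IA g).symm a) x) (extChartAt IA g g) :=
        (hP.continuous.comp (Continuous.prodMk_left x)).continuousAt.comp
          (continuousAt_extChartAt_symm g)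
      have hev : ∀ᶠ a in nhds (extChartAt IA g g),
          P ((extChartAt IA g).symm a) x ∈ (extChartAt I x).source := by
        refine hcont.eventually_mem ?_
        rw [hgg, hg]
        exact extChartAt_source_mem_nhds x
      filter_upwards [hev, (isOpen_extChartAt_target (I := IA) g).mem_nhds hat] with a ha hat'
      have e1 := fderiv_familyInCharts_inr hP (g := g) hat' hyt (by rwa [hxx])
        (W ((extChartAt I x).symm (extChartAt I x x)))
      have e2 := mpullbackWithin_extChartAt_symm W hyt
      have e3 : familyInCharts IA I P g x (a, extChartAt I x x) ∈ (extChartAt I x).target :=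
        (extChartAt I x).map_source (by rwa [hxx])
      have e4 := mpullbackWithin_extChartAt_symm W e3
      rw [I.range_eq_univ] at e2 e4
      have e5 : (extChartAt I x).symm (familyInCharts IA I P g x (a, extChartAt I x x)) =
          P ((extChartAt IA g).symm a) ((extChartAt I x).symm (extChartAt I x x)) :=
        (extChartAt I x).left_inv (by rwa [hxx])
      have e6 : ∀ x', P ((extChartAt IA g).symm a) ((extChartAt I x).symm (extChartAt I x x)) = x' →
        (mfderiv I 𝓘(ℝ, E) (extChartAt I x)
          (P ((extChartAt IA g).symm a) ((extChartAt I x).symm (extChartAt I x x))) : E →L[ℝ] E)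
          (W (P ((extChartAt IA g).symm a) ((extChartAt I x).symm (extChartAt I x x)))) =
        (mfderiv I 𝓘(ℝ, E) (extChartAt I x) x' : E →L[ℝ] E) (W x') := by
        rintro _ rfl; rfl
      refine (congrArg (fun w : E => fderiv ℝ (familyInCharts IA I P g x)
        (a, extChartAt I x x) (0, w)) e2).trans (e1.trans (Eq.trans ?_ e4.symm))
      refine Eq.trans ?_ (e6 _ e5.symm)
      exact congrArg (mfderiv I 𝓘(ℝ, E) (extChartAt I x)
          (P ((extChartAt IA g).symm a) ((extChartAt I x).symm (extChartAt I x x))) : E →L[ℝ] E)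
          (hinv _ _)
  exact (congrArg _ ((congrFun VectorField.lieBracketWithin_univ _).trans key)).trans (map_zero _)

/-- A velocity field of a smooth family of maps is smooth. -/
theorem isSmoothVectorField_velocity {P : G → M → M}
    (hP : ContMDiff (IA.prod I) I ∞ (fun z : G × M => P z.1 z.2)) {g : G} (hg : ∀ x, P g x = x)
    (ξ : A) {V : (x : M) → TangentSpace I x}
    (hV : ∀ x, (V x : E) = (mfderiv IA I (fun g => P g x) g : A →L[ℝ] E) ξ) :
    IsSmoothVectorField I V := by
  intro x
  rw [Bundle.contMDiffAt_section]
  have h0 : ContDiffAt ℝ ∞ (familyInCharts IA I P g x) (extChartAt IA g g, extChartAt I x x) := by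
    refine contDiffAt_familyInCharts hP (mem_extChartAt_target g) (mem_extChartAt_target x) ?_
    rw [extChartAt_to_inv, extChartAt_to_inv, hg]
    exact mem_extChartAt_source x
  have h1 : ContDiffAt ℝ ∞ (fun y => fderiv ℝ (familyInCharts IA I P g x)
      (extChartAt IA g g, y) (ξ, 0)) (extChartAt I x x) :=
    ((h0.fderiv_right (m := ∞) (by simp)).comp (f := fun y : E => (extChartAt IA g g, y))
      (extChartAt I x x) (contDiffAt_const.prodMk contDiffAt_id)).clm_apply contDiffAt_const
  refine (h1.contMDiffAt.comp x (contMDiffAt_extChartAt (I := I))).congr_of_eventuallyEq ?_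
  filter_upwards [extChartAt_source_mem_nhds (I := I) x] with z hz
  rw [Function.comp_apply, fderiv_familyInCharts_inl hP hg ((extChartAt I x).map_source hz),
    (extChartAt I x).left_inv hz, ← hV]
  exact trivializationAt_snd_eq_mfderiv x ⟨z, V z⟩ (by rwa [extChartAt_source] at hz)

omit [IA.Boundaryless] [I.Boundaryless] [IsManifold I ∞ M] in
/-- The tangent maps of a smooth family form a smooth family, because they are restrictions of the
tangent map of `(g, x) ↦ P g x` to vectors `(0, v)`. -/
theorem contMDiff_tangentMap_family [IsManifold I ∞ M] {P : G → M → M}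
    (hP : ContMDiff (IA.prod I) I ∞ (fun z : G × M => P z.1 z.2)) :
    ContMDiff (IA.prod I.tangent) I.tangent ∞
      (fun z : G × TangentBundle I M => tangentMap I I (P z.1) z.2) := by
  have h1 : ContMDiff (IA.prod I.tangent) IA.tangent ∞
      (fun z : G × TangentBundle I M => (⟨z.1, 0⟩ : TangentBundle IA G)) :=
    (Bundle.contMDiff_zeroSection ℝ (TangentSpace IA : G → Type _)).comp contMDiff_fst
  have h2 := (hP.contMDiff_tangentMap (m := ∞) (by simp)).comp
    ((contMDiff_equivTangentBundleProd_symm (I := IA) (M := G) (I' := I) (M' := M) (n := ∞)).comp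
      (h1.prodMk contMDiff_snd))
  refine h2.congr fun z => ?_
  refine Bundle.TotalSpace.ext rfl (heq_of_eq ?_)
  have h3 := mfderiv_apply_mfderiv_of_eventuallyEq (I := I) (I₁ := IA.prod I) (I₂ := I)
    (f := fun x : M => (z.1, x)) (g := fun z : G × M => P z.1 z.2) (h := P z.1) (x := z.2.proj)
    (hP.mdifferentiable (by simp) _)
    ((contMDiff_const.prodMk contMDiff_id).mdifferentiable (n := ∞) (by simp) _)
    (by simp) z.2.snd
  rw [mfderiv_prod_right] at h3
  exact h3.symm

omit [IA.Boundaryless] [I.Boundaryless] [IsManifold I ∞ M] in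
theorem contMDiff_tangentLift_family [IsManifold I ∞ M] {P : G → M → M}
    (hP : ContMDiff (IA.prod I) I ∞ (fun z : G × M => P z.1 z.2)) :
    ContMDiff (IA.prod (modelTQR I)) (modelTQR I) ∞
      (fun z : G × TQR I M => tangentLift I (P z.1) z.2) :=
  ((contMDiff_tangentMap_family hP).comp (contMDiff_fst.prodMk
    (contMDiff_fst.comp contMDiff_snd))).prodMk (contMDiff_snd.comp contMDiff_snd)

/-- The complete lift of a velocity field is the velocity field of the lifted family. Its fibre
component is a mixed second derivative of the family. -/
theorem completeLift_velocity {P : G → M → M}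
    (hP : ContMDiff (IA.prod I) I ∞ (fun z : G × M => P z.1 z.2)) {g : G} (hg : ∀ x, P g x = x)
    (ξ : A) {X : (x : M) → TangentSpace I x}
    (hX : ∀ x, (X x : E) = (mfderiv IA I (fun g => P g x) g : A →L[ℝ] E) ξ) (p : TQR I M) :
    (completeLift I X p : (E × E) × ℝ) =
      (mfderiv IA (modelTQR I) (fun g => tangentLift I (P g) p) g :
        A →L[ℝ] ((E × E) × ℝ)) ξ := by
  set q := p.1.proj with hq
  obtain ⟨u, hu⟩ : ∃ u : E, u = p.1.snd := ⟨_, rfl⟩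
  set f := familyInCharts IA I P g q with hf
  set a := extChartAt IA g g with ha
  set y := extChartAt I q q with hy
  have hyt : y ∈ (extChartAt I q).target := mem_extChartAt_target q
  have hat : a ∈ (extChartAt IA g).target := mem_extChartAt_target g
  have hgg : (extChartAt IA g).symm a = g := extChartAt_to_inv g
  have hqq : (extChartAt I q).symm y = q := extChartAt_to_inv q
  have hκ (v : E) : (mfderiv I 𝓘(ℝ, E) (extChartAt I q) q : E →L[ℝ] E) v = v := by
    rw [mfderiv_extChartAt_self]; rfl
  have hPs : P ((extChartAt IA g).symm a) ((extChartAt I q).symm y) ∈ (extChartAt I q).source := by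
    rw [hgg, hqq, hg]; exact mem_extChartAt_source q
  have hfd : ContDiffAt ℝ ∞ f (a, y) := contDiffAt_familyInCharts hP hat hyt hPs
  have hs := hfd.isSymmSndFDerivAt (by simp; norm_cast) (ξ, 0) (0, u)
  have h1 : HasFDerivAt f (fderiv ℝ f (a, y)) (a, y) :=
    (hfd.differentiableAt (by simp)).hasFDerivAt
  have h2 : HasFDerivAt (fderiv ℝ f) (fderiv ℝ (fderiv ℝ f) (a, y)) (a, y) :=
    ((hfd.fderiv_right (m := 1) (by norm_cast)).differentiableAt (by simp)).hasFDerivAt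
  have hl : HasFDerivAt (fun b : A => (b, y)) (ContinuousLinearMap.inl ℝ A E) a :=
    hasFDerivAt_prodMk_left a y
  have hr : HasFDerivAt (fun z : E => (a, z)) (ContinuousLinearMap.inr ℝ A E) y :=
    hasFDerivAt_prodMk_right a y
  have hXf {z : E} (hz : z ∈ (extChartAt I q).target) : fderiv ℝ f (a, z) (ξ, 0) =
      (mfderiv I 𝓘(ℝ, E) (extChartAt I q) ((extChartAt I q).symm z) : E →L[ℝ] E)
        (X ((extChartAt I q).symm z)) :=
    (fderiv_familyInCharts_inl hP hg hz ξ).trans (congrArg _ (hX _).symm)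
  -- the complete lift
  have e1 : (X q : E) = fderiv ℝ f (a, y) (ξ, 0) := by
    refine Eq.trans ?_ (hXf hyt).symm
    rw [hqq]
    exact (hκ (X q)).symm
  have e2 : ((mfderiv I I.tangent (fun x => (⟨x, X x⟩ : TangentBundle I M)) q : E →L[ℝ] E × E)
      u).2 = fderiv ℝ (fderiv ℝ f) (a, y) (0, u) (ξ, 0) := by
    have hd : MDifferentiableAt I I.tangent (fun x => (⟨x, X x⟩ : TangentBundle I M)) q :=
      (isSmoothVectorField_velocity hP hg ξ hX).mdifferentiable (by simp) q
    rw [mfderiv_eq_fderiv_writtenInExtChartAt hd rfl]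
    have hVd := (hasFDerivAt_id y).prodMk
      ((ContinuousLinearMap.apply ℝ E ((ξ, 0) : A × E)).hasFDerivAt.comp y
      (HasFDerivAt.comp (f := fun z : E => (a, z)) y h2 hr))
    rw [(hVd.congr_of_eventuallyEq ?_).fderiv]
    · rfl
    · filter_upwards [(isOpen_extChartAt_target (I := I) q).mem_nhds hyt] with z hz
      have hz' : (extChartAt I q).symm z ∈ (chartAt H q).source := by
        rw [← extChartAt_source I]; exact (extChartAt I q).map_target hz
      refine (extChartAt_tangent_apply ⟨q, X q⟩ ⟨_, X ((extChartAt I q).symm z)⟩ hz').trans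
        (Prod.ext ((extChartAt I q).right_inv hz) (hXf hz).symm)
  -- the velocity of the lifted family
  have hgp : tangentLift I (P g) p = p := by
    refine Prod.ext ?_ rfl
    have : P g = id := funext hg
    change tangentMap I I (P g) p.1 = p.1
    rw [this, tangentMap_id]; rfl
  have hd : MDifferentiableAt IA (modelTQR I) (fun g => tangentLift I (P g) p) g :=
    ((contMDiff_tangentLift_family hP).comp
      (contMDiff_id.prodMk contMDiff_const)).mdifferentiable (by simp) g
  have e3 := DFunLike.congr_fun (mfderiv_eq_fderiv_writtenInExtChartAt hd hgp) ξ
  have h3 : HasFDerivAt (fun b => ((f (b, y), fderiv ℝ f (b, y) (0, u)), p.2)) _ a :=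
    ((HasFDerivAt.comp (g := f) (f := fun b : A => (b, y)) a h1 hl).prodMk
      ((ContinuousLinearMap.apply ℝ E ((0, u) : A × E)).hasFDerivAt.comp a
      (HasFDerivAt.comp (f := fun b : A => (b, y)) a h2 hl))).prodMk (hasFDerivAt_const p.2 a)
  have hev : ∀ᶠ b in nhds a, P ((extChartAt IA g).symm b) q ∈ (extChartAt I q).source := by
    have hcont : ContinuousAt (fun a => P ((extChartAt IA g).symm a) q) a :=
      (hP.continuous.comp (Continuous.prodMk_left q)).continuousAt.comp
        (continuousAt_extChartAt_symm g)
    refine hcont.eventually_mem ?_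
    rw [hgg, hg]
    exact extChartAt_source_mem_nhds q
  rw [(h3.congr_of_eventuallyEq ?_).fderiv] at e3
  · refine Eq.trans ?_ e3.symm
    refine Prod.ext (Prod.ext e1 ?_) rfl
    subst hu
    exact e2.trans hs.symm
  · filter_upwards [hev, (isOpen_extChartAt_target (I := IA) g).mem_nhds hat] with b hb hb'
    refine (extChartAt_TQR_apply p (tangentLift I (P ((extChartAt IA g).symm b)) p)
      (by rwa [extChartAt_source] at hb)).trans ?_
    refine Prod.ext (Prod.ext ?_ ?_) rfl
    · exact congrArg (fun x => extChartAt I q (P ((extChartAt IA g).symm b) x)) hqq.symm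
    · have e4 := fderiv_familyInCharts_inr hP hb' hyt (by rwa [hqq]) u
      rw [hqq, hκ] at e4
      rw [hu] at e4 ⊢
      exact e4.symm

end BracketManifold

/-! ### Orbit maps of free actions -/

section OrbitMap

variable {A : Type*} [NormedAddCommGroup A] [NormedSpace ℝ A] [CompleteSpace A]
  {HA : Type*} [TopologicalSpace HA]
  {IA : ModelWithCorners ℝ A HA} [IA.Boundaryless] {G : Type*} [TopologicalSpace G]
  [ChartedSpace HA G] [Group G] [LieGroup IA ∞ G]
  {E : Type*} [NormedAddCommGroup E] [NormedSpace ℝ E] {H : Type*} [TopologicalSpace H]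
  {I : ModelWithCorners ℝ E H} {M : Type*} [TopologicalSpace M] [ChartedSpace H M] [I.Boundaryless]
  [IsManifold I ∞ M] [MulAction G M]

/-- The orbit maps of a free smooth action are immersions at the identity. If `ξ` is in the kernel,
then the orbit map has zero derivative along the left-invariant vector field of `ξ`, so it is
constant along an integral curve of this field; by freeness, the integral curve is constant. -/
theorem eq_zero_of_mfderiv_smul_eq_zero [ContMDiffSMul IA I ∞ G M] [IsCancelSMul G M]
    (x : M) (ξ : A)
    (hξ : (mfderiv IA I (fun g : G => g • x) 1 : A →L[ℝ] E) ξ = 0) : ξ = 0 := by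
  have hG : IsManifold IA ∞ G := ContMDiffMul.toIsManifold (G := G)
  -- the left-invariant vector field of `ξ`
  set v : (g : G) → TangentSpace IA g :=
    fun g => (mfderiv IA IA (fun h : G => g * h) 1 : A →L[ℝ] A) ξ with hv
  have hmul : ContMDiff (IA.prod IA) IA ∞ (fun z : G × G => z.2 * z.1) :=
    contMDiff_snd.mul contMDiff_fst
  have hvs : IsSmoothVectorField IA v :=
    isSmoothVectorField_velocity (P := fun h g : G => g * h) hmul (g := 1) (fun g => mul_one g) ξ
      (fun g => rfl)
  have hsmul : ContMDiff (IA.prod I) I ∞ (fun z : G × M => z.1 • z.2) := contMDiff_smul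
  have horb (y : M) : ContMDiff IA I ∞ (fun g : G => g • y) :=
    hsmul.comp (contMDiff_id.prodMk contMDiff_const)
  have hact (g : G) : ContMDiff I I ∞ (fun y : M => g • y) :=
    hsmul.comp (contMDiff_const.prodMk contMDiff_id)
  have hker (g : G) : (mfderiv IA I (fun g : G => g • x) g : A →L[ℝ] E) (v g) = 0 := by
    have hL : ContMDiff IA IA ∞ (fun h : G => g * h) := contMDiff_mul_left
    have h1 := mfderiv_apply_mfderiv_of_eventuallyEq (h := fun h : G => (g * h) • x)
      (f := fun h : G => g * h) (g := fun g : G => g • x) (x := 1)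
      ((horb x).mdifferentiable (by simp) _) (hL.mdifferentiable (by simp) 1) (by simp) ξ
    have h2 := mfderiv_apply_mfderiv_of_eventuallyEq (h := fun h : G => (g * h) • x)
      (f := fun h : G => h • x) (g := fun y : M => g • y) (x := (1 : G))
      ((hact g).mdifferentiable (by simp) _) ((horb x).mdifferentiable (by simp) 1)
      (by simp [mul_smul]) ξ
    have h3 : ∀ g', g * 1 = g' → ((mfderiv IA I (fun g : G => g • x) (g * 1) : A →L[ℝ] E) (v g) =
      (mfderiv IA I (fun g : G => g • x) g' : A →L[ℝ] E) (v g)) := by rintro _ rfl; rfl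
    rw [hξ, map_zero] at h2
    exact (h3 _ (mul_one g)).symm.trans (h1.trans h2.symm)
  -- the integral curve `γ` of `v` through `1`; both `γ t • x` and `x` are integral curves of `0`
  obtain ⟨γ, hγ0, hγ⟩ := exists_isMIntegralCurveAt_of_contMDiffAt_boundaryless (I := IA) (v := v)
    (t₀ := 0) (x₀ := (1 : G)) ((hvs 1).of_le (by norm_cast))
  have hcongr : ∀ (c : ℝ → M) (t : ℝ) (D D' : ℝ →L[ℝ] E), D = D' →
      HasMFDerivAt 𝓘(ℝ, ℝ) I c t D → HasMFDerivAt 𝓘(ℝ, ℝ) I c t D' := by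
    rintro c t D _ rfl h; exact h
  have hc : IsMIntegralCurveAt (I := I) (fun t => γ t • x) (fun _ => 0) 0 := by
    filter_upwards [hγ] with t ht
    have h1 := (((horb x).mdifferentiable (by simp) (γ t)).hasMFDerivAt).comp t ht
    have e : (1 : ℝ →L[ℝ] ℝ).smulRight (0 : E) =
        (mfderiv IA I (fun g : G => g • x) (γ t) : A →L[ℝ] E).comp
          ((1 : ℝ →L[ℝ] ℝ).smulRight (v (γ t) : A)) := by
      refine ContinuousLinearMap.ext fun s => ?_
      have h2 := (map_smul (mfderiv IA I (fun g : G => g • x) (γ t) : A →L[ℝ] E) s (v (γ t))).trans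
        (congrArg (fun w : E => s • w) (hker (γ t)))
      exact h2.symm
    exact hcongr _ t _ _ e.symm h1
  have hc' : IsMIntegralCurveAt (I := I) (fun _ => x) (fun _ : M => 0) 0 := by
    refine Filter.Eventually.of_forall fun t => ?_
    have e : (1 : ℝ →L[ℝ] ℝ).smulRight (0 : E) = 0 :=
      ContinuousLinearMap.ext fun s => smul_zero s
    exact hcongr _ t _ _ e.symm (hasMFDerivAt_const (I := 𝓘(ℝ, ℝ)) (I' := I) x t)
  have heq := isMIntegralCurveAt_eventuallyEq_of_contMDiffAt_boundaryless (I := I)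
    (v := fun _ : M => 0)
    ((Bundle.contMDiff_zeroSection ℝ (TangentSpace I : M → Type _)).contMDiffAt) hc hc'
    (by simp [hγ0])
  have hγ1 : ∀ᶠ t in nhds 0, γ t = 1 := by
    filter_upwards [heq] with t ht
    exact IsCancelSMul.right_cancel _ _ x (by simpa using ht)
  have h4 := hγ.hasMFDerivAt
  have h5 : HasMFDerivAt 𝓘(ℝ, ℝ) IA γ 0 (0 : ℝ →L[ℝ] A) :=
    (hasMFDerivAt_const (1 : G) (0 : ℝ)).congr_of_eventuallyEq hγ1
  have h6 := DFunLike.congr_fun (hasMFDerivAt_unique h4 h5) (1 : ℝ)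
  have h7 : (v (γ 0) : A) = 0 := by
    have h8 : (v (γ 0) : A) = (1 : ℝ) • (v (γ 0) : A) := (one_smul ℝ (v (γ 0) : A)).symm
    exact h8.trans h6
  have h9 : (v 1 : A) = ξ := by
    have h10 : (fun h : G => 1 * h) = id := funext one_mul
    have h11 : (v 1 : A) = (mfderiv IA IA (fun h : G => 1 * h) 1 : A →L[ℝ] A) ξ := rfl
    rw [h11, h10, mfderiv_id]; rfl
  rw [hγ0] at h7
  exact h9.symm.trans h7

end OrbitMap

/-! ### Local slices -/

section InverseFunction

/-- The inverse function theorem for smooth maps: unlike `ContDiffAt.to_localInverse`, the local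
inverse is smooth on a neighbourhood and not only at the image point. -/
theorem exists_openPartialHomeomorph_contDiffAt_symm {V F : Type*} [NormedAddCommGroup V]
    [NormedSpace ℝ V] [CompleteSpace V] [NormedAddCommGroup F] [NormedSpace ℝ F] {f : V → F}
    {v : V} {U : Set V} (hU : IsOpen U) (hv : v ∈ U) (hf : ∀ z ∈ U, ContDiffAt ℝ ∞ f z)
    (e : V ≃L[ℝ] F) (he : HasFDerivAt f (e : V →L[ℝ] F) v) :
    ∃ Φ : OpenPartialHomeomorph V F, v ∈ Φ.source ∧ Φ.source ⊆ U ∧ (Φ : V → F) = f ∧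
      ∀ z ∈ Φ.target, ContDiffAt ℝ ∞ Φ.symm z := by
  set S := U ∩ fderiv ℝ f ⁻¹' Set.range ((↑) : (V ≃L[ℝ] F) → V →L[ℝ] F) with hS
  have hc : ContinuousOn (fderiv ℝ f) U := fun z hz =>
    ((hf z hz).fderiv_right (m := ∞) (by simp)).continuousAt.continuousWithinAt
  have hSo : IsOpen S := hc.isOpen_inter_preimage hU ContinuousLinearEquiv.isOpen
  set Φ₀ := (hf v hv).toOpenPartialHomeomorph f he (by simp)
  refine ⟨Φ₀.restrOpen S hSo, ?_, ?_, rfl, ?_⟩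
  · exact ⟨(hf v hv).mem_toOpenPartialHomeomorph_source he (by simp), hv, e, he.fderiv.symm⟩
  · exact fun z hz => hz.2.1
  · intro z hz
    have hz' := (Φ₀.restrOpen S hSo).map_target hz
    obtain ⟨-, hzU, e', he'⟩ := hz'
    refine (Φ₀.restrOpen S hSo).contDiffAt_symm hz (f₀' := e') ?_ (hf _ hzU)
    rw [he']
    exact ((hf _ hzU).differentiableAt (by simp)).hasFDerivAt

end InverseFunction

section Complement

/-- An injective linear map `T : A → F` extends to an isomorphism `A × ℝᵏ ≃ F`. -/
theorem exists_equiv_extending_injective {A F : Type*} [NormedAddCommGroup A] [NormedSpace ℝ A]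
    [FiniteDimensional ℝ A] [NormedAddCommGroup F] [NormedSpace ℝ F] [FiniteDimensional ℝ F]
    (T : A →L[ℝ] F) (hT : Function.Injective T) {k : ℕ}
    (hk : k = Module.finrank ℝ F - Module.finrank ℝ A) :
    ∃ (ι : EuclideanSpace ℝ (Fin k) →L[ℝ] F) (e : (A × EuclideanSpace ℝ (Fin k)) ≃L[ℝ] F),
      ∀ ξ w, e (ξ, w) = T ξ + ι w := by
  obtain ⟨C, hC⟩ := Submodule.exists_isCompl (LinearMap.range T.toLinearMap)
  have h1 := Submodule.finrank_add_eq_of_isCompl hC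
  have h2 : Module.finrank ℝ (LinearMap.range T.toLinearMap) = Module.finrank ℝ A :=
    LinearMap.finrank_range_of_inj hT
  have h3 : Module.finrank ℝ (EuclideanSpace ℝ (Fin k)) = Module.finrank ℝ C := by
    rw [finrank_euclideanSpace_fin]; omega
  let eC : EuclideanSpace ℝ (Fin k) ≃ₗ[ℝ] C := LinearEquiv.ofFinrankEq _ _ h3
  let eT : A ≃ₗ[ℝ] LinearMap.range T.toLinearMap := LinearEquiv.ofInjective T.toLinearMap hT
  let e : (A × EuclideanSpace ℝ (Fin k)) ≃ₗ[ℝ] F :=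
    (eT.prodCongr eC).trans (Submodule.prodEquivOfIsCompl _ _ hC)
  refine ⟨(C.subtype ∘ₗ eC.toLinearMap).toContinuousLinearMap, e.toContinuousLinearEquiv, ?_⟩
  intro ξ w
  simp [e, eT]

end Complement

section Slice

variable {A : Type*} [NormedAddCommGroup A] [NormedSpace ℝ A] [FiniteDimensional ℝ A]
  {HA : Type*} [TopologicalSpace HA]
  {IA : ModelWithCorners ℝ A HA} [IA.Boundaryless] {G : Type*} [TopologicalSpace G]
  [ChartedSpace HA G] [Group G] [LieGroup IA ∞ G]
  {E : Type*} [NormedAddCommGroup E] [NormedSpace ℝ E] [FiniteDimensional ℝ E]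
  {H : Type*} [TopologicalSpace H]
  {I : ModelWithCorners ℝ E H} {M : Type*} [TopologicalSpace M] [ChartedSpace H M] [I.Boundaryless]
  [IsManifold I ∞ M] [MulAction G M]

variable (IA I) in
/-- Through each point of a free smooth action passes a submanifold `σ` such that
`(g, w) ↦ g • σ w` is a local diffeomorphism near `(1, 0)`; its local inverse is `(γ, ρ)`. -/
theorem exists_local_slice [ContMDiffSMul IA I ∞ G M] [IsCancelSMul G M] (x : M) {k : ℕ}
    (hk : k = Module.finrank ℝ E - Module.finrank ℝ A) :
    ∃ (σ : EuclideanSpace ℝ (Fin k) → M) (ρ : M → EuclideanSpace ℝ (Fin k)) (γ : M → G)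
      (V : Set (EuclideanSpace ℝ (Fin k))) (N : Set M) (O : Set G),
      IsOpen V ∧ 0 ∈ V ∧ IsOpen N ∧ IsOpen O ∧ 1 ∈ O ∧ σ 0 = x ∧
      ContMDiffOn (𝓡 k) I ∞ σ V ∧ ContMDiffOn I (𝓡 k) ∞ ρ N ∧
      (∀ y ∈ N, γ y • σ (ρ y) = y) ∧
      ∀ g ∈ O, ∀ w ∈ V, g • σ w ∈ N ∧ ρ (g • σ w) = w := by
  have hG : IsManifold IA ∞ G := ContMDiffMul.toIsManifold (G := G)
  have : CompleteSpace A := FiniteDimensional.complete ℝ A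
  have : CompleteSpace E := FiniteDimensional.complete ℝ E
  have hsmul : ContMDiff (IA.prod I) I ∞ (fun z : G × M => z.1 • z.2) := contMDiff_smul
  set κ := extChartAt IA (1 : G) with hκ
  set φ := extChartAt I x with hφ
  set T : A →L[ℝ] E := mfderiv IA I (fun g : G => g • x) 1 with hT
  have hTi : Function.Injective T := by
    refine (injective_iff_map_eq_zero T).2 fun ξ hξ => ?_
    exact eq_zero_of_mfderiv_smul_eq_zero (IA := IA) (I := I) x ξ hξ
  obtain ⟨ι, e, he⟩ := exists_equiv_extending_injective T hTi hk
  set F := familyInCharts IA I (fun (g : G) (y : M) => g • y) 1 x with hF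
  set j : A × EuclideanSpace ℝ (Fin k) → A × E := fun z => (z.1, φ x + ι z.2) with hj
  have hjs : ContDiff ℝ ∞ j := contDiff_fst.prodMk
    (contDiff_const.add (ι.contDiff.comp contDiff_snd))
  set f : A × EuclideanSpace ℝ (Fin k) → E := fun z => F (j z) with hf
  set σ : EuclideanSpace ℝ (Fin k) → M := fun w => φ.symm (φ x + ι w) with hσ
  have hσ0 : σ 0 = x := by simp only [hσ, map_zero, add_zero]; exact extChartAt_to_inv x
  have hκ1 : κ.symm (κ 1) = 1 := extChartAt_to_inv (1 : G)
  -- the set on which the map `f`, the action in charts, is smooth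
  set U₀ : Set (A × EuclideanSpace ℝ (Fin k)) := {z | z.1 ∈ κ.target ∧ φ x + ι z.2 ∈ φ.target}
    with hU₀
  have hU₀o : IsOpen U₀ :=
    ((isOpen_extChartAt_target (1 : G)).preimage continuous_fst).inter
      ((isOpen_extChartAt_target x).preimage
        (continuous_const.add (ι.continuous.comp continuous_snd)))
  have hact : ContinuousOn (fun z : A × EuclideanSpace ℝ (Fin k) => κ.symm z.1 • σ z.2) U₀ := by
    intro z hz
    have h1 : ContinuousAt (fun z : A × EuclideanSpace ℝ (Fin k) => κ.symm z.1) z :=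
      ContinuousAt.comp (g := κ.symm) (f := Prod.fst)
        ((contMDiffAt_extChartAt_symm (I := IA) (n := ∞) hz.1).continuousAt) continuousAt_fst
    have h2 : ContinuousAt (fun z : A × EuclideanSpace ℝ (Fin k) => σ z.2) z :=
      ContinuousAt.comp (g := φ.symm)
        (f := fun z : A × EuclideanSpace ℝ (Fin k) => φ x + ι z.2)
        ((contMDiffAt_extChartAt_symm (I := I) (n := ∞) hz.2).continuousAt)
        (continuous_const.add (ι.continuous.comp continuous_snd)).continuousAt
    exact (hsmul.continuous.continuousAt.comp (h1.prodMk h2)).continuousWithinAt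
  set U : Set (A × EuclideanSpace ℝ (Fin k)) :=
    U₀ ∩ (fun z => κ.symm z.1 • σ z.2) ⁻¹' φ.source with hU
  have hUo : IsOpen U := hact.isOpen_inter_preimage hU₀o (isOpen_extChartAt_source x)
  have hU0 : (κ 1, (0 : EuclideanSpace ℝ (Fin k))) ∈ U := by
    refine ⟨⟨mem_extChartAt_target (1 : G), ?_⟩, ?_⟩
    · simp only [map_zero, add_zero]; exact mem_extChartAt_target x
    · simp only [Set.mem_preimage, hκ1, hσ0, one_smul]; exact mem_extChartAt_source x
  have hfU : ∀ z ∈ U, ContDiffAt ℝ ∞ f z := by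
    rintro z ⟨⟨h1, h2⟩, h3⟩
    exact (contDiffAt_familyInCharts hsmul (z := j z) h1 h2 h3).comp z hjs.contDiffAt
  -- at the base point the derivative is the orbit map in `A` and a complement of its range in `ℝᵏ`
  have hder : HasFDerivAt f (e : (A × EuclideanSpace ℝ (Fin k)) →L[ℝ] E) (κ 1, 0) := by
    have hj0 : j (κ 1, 0) = (κ 1, φ x) := by simp [hj]
    have hFd : HasFDerivAt F (fderiv ℝ F (κ 1, φ x)) (κ 1, φ x) := by
      refine (ContDiffAt.differentiableAt (n := ∞) ?_ (by simp)).hasFDerivAt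
      refine contDiffAt_familyInCharts hsmul (mem_extChartAt_target (1 : G))
        (mem_extChartAt_target x) ?_
      rw [extChartAt_to_inv, extChartAt_to_inv, one_smul]
      exact mem_extChartAt_source x
    have hinl (ξ : A) : fderiv ℝ F (κ 1, φ x) (ξ, 0) = T ξ := by
      refine (fderiv_familyInCharts_inl hsmul (g := 1) (fun y => one_smul G y)
        (mem_extChartAt_target x) ξ).trans ?_
      rw [extChartAt_to_inv, mfderiv_extChartAt_self]
      rfl
    have hinr (v : E) : fderiv ℝ F (κ 1, φ x) (0, v) = v := by
      have h1 := HasFDerivAt.comp (f := fun y : E => (κ 1, y)) (φ x) hFd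
        (hasFDerivAt_prodMk_right (κ 1) (φ x))
      have h2 : HasFDerivAt (F ∘ fun y : E => (κ 1, y)) (ContinuousLinearMap.id ℝ E) (φ x) := by
        refine (hasFDerivAt_id (φ x)).congr_of_eventuallyEq ?_
        filter_upwards [extChartAt_target_mem_nhds (I := I) x] with y hy
        change φ (κ.symm (κ 1) • φ.symm y) = y
        rw [hκ1, one_smul]
        exact φ.right_inv hy
      exact DFunLike.congr_fun (h1.unique h2) v
    have hjd : HasFDerivAt j ((ContinuousLinearMap.fst ℝ A (EuclideanSpace ℝ (Fin k))).prod
        (ι.comp (ContinuousLinearMap.snd ℝ A (EuclideanSpace ℝ (Fin k))))) (κ 1, 0) :=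
      hasFDerivAt_fst.prodMk
        ((ι.hasFDerivAt.comp (κ 1, (0 : EuclideanSpace ℝ (Fin k))) hasFDerivAt_snd).const_add (φ x))
    rw [← hj0] at hFd
    have h1 := hFd.comp _ hjd
    rw [hj0] at h1
    refine h1.congr_fderiv (ContinuousLinearMap.ext fun z => ?_)
    have h2 : ((z.1, ι z.2) : A × E) = (z.1, 0) + (0, ι z.2) := by simp
    change fderiv ℝ F (κ 1, φ x) (z.1, ι z.2) = e (z.1, z.2)
    rw [he, h2, map_add, hinl, hinr]
  obtain ⟨Φ, hΦ0, hΦU, hΦf, hΦs⟩ :=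
    exists_openPartialHomeomorph_contDiffAt_symm hUo hU0 hfU e hder
  have hΦval (z : A × EuclideanSpace ℝ (Fin k)) : Φ z = φ (κ.symm z.1 • σ z.2) := by
    rw [hΦf]; rfl
  -- a product neighbourhood
  have hnhds : {z : G × EuclideanSpace ℝ (Fin k) | z.1 ∈ κ.source ∧ (κ z.1, z.2) ∈ Φ.source} ∈
      nhds ((1 : G), (0 : EuclideanSpace ℝ (Fin k))) := by
    refine Filter.inter_mem ?_ ?_
    · exact continuousAt_fst.preimage_mem_nhds (extChartAt_source_mem_nhds (1 : G))
    · have : ContinuousAt (fun z : G × EuclideanSpace ℝ (Fin k) => (κ z.1, z.2)) (1, 0) :=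
        (ContinuousAt.comp (g := κ) (f := Prod.fst) (continuousAt_extChartAt (1 : G))
          continuousAt_fst).prodMk continuousAt_snd
      exact this.preimage_mem_nhds (Φ.open_source.mem_nhds hΦ0)
  obtain ⟨O, hO, V, hV, hOV⟩ := mem_nhds_prod_iff.1 hnhds
  obtain ⟨O', hO'O, hO', h1O⟩ := mem_nhds_iff.1 hO
  obtain ⟨V', hV'V, hV', h0V⟩ := mem_nhds_iff.1 hV
  -- near `x`, the inverse of `(g, w) ↦ g • σ w` is `Φ⁻¹ ∘ φ`, read in the chart `κ` of `G`
  refine ⟨σ, fun y => (Φ.symm (φ y)).2, fun y => κ.symm (Φ.symm (φ y)).1, V',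
    φ.source ∩ φ ⁻¹' Φ.target, O', hV', h0V, ?_, hO', h1O, hσ0, ?_, ?_, ?_, ?_⟩
  · exact (continuousOn_extChartAt x).isOpen_inter_preimage (isOpen_extChartAt_source x)
      Φ.open_target
  · intro w hw
    have h1 : (κ 1, w) ∈ Φ.source := (hOV (Set.mk_mem_prod (hO'O h1O) (hV'V hw))).2
    have h2 := (hΦU h1).1.2
    have h3 : ContMDiffAt (𝓡 k) 𝓘(ℝ, E) ∞ (fun w => φ x + ι w) w :=
      (contDiff_const.add ι.contDiff).contMDiff.contMDiffAt
    exact ((contMDiffAt_extChartAt_symm (I := I) h2).comp w h3).contMDiffWithinAt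
  · rintro y ⟨hy1, hy2⟩
    have h1 : ContMDiffAt 𝓘(ℝ, E) (𝓡 k) ∞ (fun z => (Φ.symm z).2) (φ y) :=
      (contDiffAt_snd.comp _ (hΦs _ hy2)).contMDiffAt
    exact (h1.comp y
      (contMDiffAt_extChartAt' (by rwa [hφ, extChartAt_source] at hy1))).contMDiffWithinAt
  · rintro y ⟨hy1, hy2⟩
    have h1 := Φ.right_inv hy2
    rw [hΦval] at h1
    have h2 := hΦU (Φ.map_target hy2)
    exact φ.injOn h2.2 hy1 h1
  · intro g hg w hw
    have h1 : g ∈ κ.source ∧ (κ g, w) ∈ Φ.source := hOV (Set.mk_mem_prod (hO'O hg) (hV'V hw))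
    have h2 := hΦval (κ g, w)
    simp only [κ.left_inv h1.1] at h2
    have h3 := (hΦU h1.2).2
    simp only [Set.mem_preimage, κ.left_inv h1.1] at h3
    refine ⟨⟨h3, ?_⟩, ?_⟩
    · rw [Set.mem_preimage, ← h2]; exact Φ.map_source h1.2
    · change (Φ.symm (φ (g • σ w))).2 = w
      rw [← h2, Φ.left_inv h1.2]

end Slice

/-! ### Slices of free proper actions -/

section GlobalSlice

variable {E : Type*} [NormedAddCommGroup E] [NormedSpace ℝ E] {H : Type*} [TopologicalSpace H]

/-- A slice of an action of `G` on `M`: a smooth section `sec`, defined on the open set `dom` of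
`ℝᵏ`, that meets each orbit in the invariant open set `sat` exactly once. The smooth invariant map
`ret` sends a point of `sat` to the parameter of the point where its orbit meets the slice. -/
structure Slice (I : ModelWithCorners ℝ E H) (G M : Type*) [Group G] [TopologicalSpace M]
    [ChartedSpace H M] [MulAction G M] (k : ℕ) where
  /-- The parameter domain of the slice. -/
  dom : Set (EuclideanSpace ℝ (Fin k))
  /-- The union of the orbits that meet the slice. -/
  sat : Set M
  /-- The parametrization of the slice. -/
  sec : EuclideanSpace ℝ (Fin k) → M
  /-- The retraction to the parameter domain along the orbits. -/
  ret : M → EuclideanSpace ℝ (Fin k)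
  isOpen_dom : IsOpen dom
  isOpen_sat : IsOpen sat
  contMDiffOn_sec : ContMDiffOn (𝓡 k) I ∞ sec dom
  contMDiffOn_ret : ContMDiffOn I (𝓡 k) ∞ ret sat
  smul_mem : ∀ (g : G) {y : M}, y ∈ sat → g • y ∈ sat
  ret_smul : ∀ (g : G) {y : M}, y ∈ sat → ret (g • y) = ret y
  ret_mem : ∀ {y : M}, y ∈ sat → ret y ∈ dom
  exists_smul_sec : ∀ {y : M}, y ∈ sat → ∃ g : G, g • sec (ret y) = y
  sec_mem : ∀ {w}, w ∈ dom → sec w ∈ sat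
  ret_sec : ∀ {w}, w ∈ dom → ret (sec w) = w

/-- For a free proper action, points near `x` can be moved to points near `x` only by group
elements near `1`. -/
theorem exists_nhds_smul_mem_imp_mem {G M : Type*} [TopologicalSpace G] [Group G]
    [TopologicalSpace M] [MulAction G M] [IsCancelSMul G M] [ProperSMul G M] (x : M) {O : Set G}
    (hO : IsOpen O) (h1 : 1 ∈ O) :
    ∃ W : Set M, IsOpen W ∧ x ∈ W ∧ ∀ (g : G), ∀ y ∈ W, g • y ∈ W → g ∈ O := by
  have hC : IsClosed ((fun z : G × M => (z.1 • z.2, z.2)) '' (Prod.fst ⁻¹' Oᶜ)) :=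
    (ProperSMul.isProperMap_smul_pair (G := G) (X := M)).isClosedMap _
      (hO.isClosed_compl.preimage continuous_fst)
  have hx : (x, x) ∈ ((fun z : G × M => (z.1 • z.2, z.2)) '' (Prod.fst ⁻¹' Oᶜ))ᶜ := by
    rintro ⟨⟨g, y⟩, hg, e⟩
    obtain ⟨e1, e2⟩ := Prod.mk.inj e
    simp only at e2
    subst e2
    refine hg ?_
    have : g = 1 := IsCancelSMul.right_cancel g 1 y (e1.trans (one_smul G y).symm)
    simpa [this] using h1
  obtain ⟨W₁, hW₁, W₂, hW₂, hW⟩ := mem_nhds_prod_iff.1 (hC.isOpen_compl.mem_nhds hx)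
  obtain ⟨W, hWs, hWo, hxW⟩ := mem_nhds_iff.1 (Filter.inter_mem hW₁ hW₂)
  refine ⟨W, hWo, hxW, fun g y hy hgy => ?_⟩
  by_contra hg
  exact hW (Set.mk_mem_prod (hWs hgy).1 (hWs hy).2) ⟨(g, y), hg, rfl⟩

variable {A : Type*} [NormedAddCommGroup A] [NormedSpace ℝ A] [FiniteDimensional ℝ A]
  {HA : Type*} [TopologicalSpace HA]
  (IA : ModelWithCorners ℝ A HA) [IA.Boundaryless] {G : Type*} [TopologicalSpace G]
  [ChartedSpace HA G] [Group G] [LieGroup IA ∞ G] [FiniteDimensional ℝ E]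
  (I : ModelWithCorners ℝ E H) {M : Type*} [TopologicalSpace M] [ChartedSpace H M] [I.Boundaryless]
  [IsManifold I ∞ M] [MulAction G M]

/-- The slice theorem for free proper actions. -/
theorem exists_slice [ContMDiffSMul IA I ∞ G M] [IsCancelSMul G M] [ProperSMul G M] (x : M)
    {k : ℕ} (hk : k = Module.finrank ℝ E - Module.finrank ℝ A) :
    ∃ S : Slice I G M k, x ∈ S.sat := by
  classical
  obtain ⟨σ, ρ, γ, V, N, O, hV, h0V, hN, hO, h1O, hσ0, hσ, hρ, hγ, hOV⟩ :=
    exists_local_slice IA I (G := G) x hk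
  obtain ⟨W, hW, hxW, hWO⟩ := exists_nhds_smul_mem_imp_mem (G := G) x hO h1O
  set B : Set (EuclideanSpace ℝ (Fin k)) := V ∩ σ ⁻¹' W with hB
  have hBo : IsOpen B := hσ.continuousOn.isOpen_inter_preimage hV hW
  have h0B : (0 : EuclideanSpace ℝ (Fin k)) ∈ B := ⟨h0V, by rwa [Set.mem_preimage, hσ0]⟩
  have hsec {w} (hw : w ∈ B) : σ w ∈ N ∧ ρ (σ w) = w := by
    simpa using hOV 1 h1O w hw.1
  have huniq {g g' : G} {w w'} (hw : w ∈ B) (hw' : w' ∈ B) (e : g • σ w = g' • σ w') :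
      w = w' := by
    have e' : (g'⁻¹ * g) • σ w = σ w' := by rw [mul_smul, e, inv_smul_smul]
    have hg : g'⁻¹ * g ∈ O := hWO _ (σ w) hw.2 (by rw [e']; exact hw'.2)
    rw [← (hOV _ hg w hw.1).2, e', (hsec hw').2]
  set sat : Set M := {y | ∃ g : G, ∃ w ∈ B, g • σ w = y} with hsat
  set r : M → EuclideanSpace ℝ (Fin k) := fun y =>
    if h : ∃ w ∈ B, ∃ g : G, g • σ w = y then h.choose else 0 with hr
  have hrval (g : G) {w} (hw : w ∈ B) : r (g • σ w) = w := by
    have h : ∃ w' ∈ B, ∃ g' : G, g' • σ w' = g • σ w := ⟨w, hw, g, rfl⟩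
    obtain ⟨h1, g', h2⟩ := h.choose_spec
    have : r (g • σ w) = h.choose := dif_pos h
    rw [this]
    exact huniq h1 hw h2
  set N' : Set M := N ∩ ρ ⁻¹' B with hN'
  have hN'o : IsOpen N' := hρ.continuousOn.isOpen_inter_preimage hN hBo
  have hN'sat {z} (hz : z ∈ N') : z ∈ sat := ⟨γ z, ρ z, hz.2, hγ z hz.1⟩
  have hrρ {z} (hz : z ∈ N') : r z = ρ z := by
    conv_lhs => rw [← hγ z hz.1]
    exact hrval _ hz.2
  have hsN' {w} (hw : w ∈ B) : σ w ∈ N' :=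
    ⟨(hsec hw).1, by rw [Set.mem_preimage, (hsec hw).2]; exact hw⟩
  have hsmulmem (g : G) {y : M} (hy : y ∈ sat) : g • y ∈ sat := by
    obtain ⟨g', w, hw, rfl⟩ := hy
    exact ⟨g * g', w, hw, mul_smul g g' _⟩
  have hrsmul (g : G) {y : M} (hy : y ∈ sat) : r (g • y) = r y := by
    obtain ⟨g', w, hw, rfl⟩ := hy
    rw [← mul_smul, hrval _ hw, hrval _ hw]
  have hsmooth (g : G) : ContMDiff I I ∞ (fun y : M => g • y) := contMDiff_smul_left IA I G M g
  -- every point of `sat` is moved by the group into the neighbourhood `N'` of the slice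
  have hnear {y : M} (hy : y ∈ sat) : ∃ g : G, g • y ∈ N' ∧ ∀ᶠ z in nhds y, g • z ∈ N' := by
    obtain ⟨g, w, hw, rfl⟩ := hy
    have h : g⁻¹ • g • σ w ∈ N' := by rw [inv_smul_smul]; exact hsN' hw
    exact ⟨g⁻¹, h, (hsmooth g⁻¹).continuous.continuousAt.eventually (hN'o.mem_nhds h)⟩
  refine ⟨⟨B, sat, σ, r, hBo, ?_, hσ.mono Set.inter_subset_left, ?_, hsmulmem, hrsmul, ?_, ?_, ?_,
    ?_⟩, 1, 0, h0B, by rw [one_smul, hσ0]⟩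
  · refine isOpen_iff_mem_nhds.2 fun y hy => ?_
    obtain ⟨g, -, hg⟩ := hnear hy
    filter_upwards [hg] with z hz
    have := hsmulmem g⁻¹ (hN'sat hz)
    rwa [inv_smul_smul] at this
  · intro y hy
    obtain ⟨g, hgy, hg⟩ := hnear hy
    have h1 : ContMDiffAt I (𝓡 k) ∞ (fun z => ρ (g • z)) y :=
      ContMDiffAt.comp (g := ρ) y (hρ.contMDiffAt (hN.mem_nhds hgy.1)) ((hsmooth g) y)
    refine (h1.congr_of_eventuallyEq ?_).contMDiffWithinAt
    filter_upwards [hg] with z hz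
    rw [← hrρ hz]
    have h2 := hrsmul g⁻¹ (hN'sat hz)
    rwa [inv_smul_smul] at h2
  · rintro y ⟨g, w, hw, rfl⟩
    rw [hrval _ hw]; exact hw
  · rintro y ⟨g, w, hw, rfl⟩
    rw [hrval _ hw]; exact ⟨g, rfl⟩
  · exact fun hw => hN'sat (hsN' hw)
  · intro w hw
    have := hrval 1 hw
    rwa [one_smul] at this

end GlobalSlice

/-! ### The orbit space as a manifold -/

section Orbits

variable {E : Type*} [NormedAddCommGroup E] [NormedSpace ℝ E] {H : Type*} [TopologicalSpace H]
  {I : ModelWithCorners ℝ E H} {G : Type*} [Group G] {M : Type*} [TopologicalSpace M]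
  [ChartedSpace H M] [MulAction G M] {k : ℕ}

/-- The orbit space of an action. -/
local notation "OrbitSpace" => Quotient (MulAction.orbitRel G M)

/-- The projection to the orbit space. -/
local notation "orb" => (Quotient.mk (MulAction.orbitRel G M) : M → OrbitSpace)

omit [TopologicalSpace M] in
theorem exists_smul_eq_out (y : M) : ∃ g : G, g • y = (orb y).out :=
  MulAction.mem_orbit_iff.1 (MulAction.orbitRel_apply.1 (Quotient.exact (Quotient.out_eq (orb y))))

omit [TopologicalSpace M] in
theorem orb_smul (g : G) (y : M) : orb (g • y) = orb y :=
  Quotient.sound (MulAction.orbitRel_apply.2 (MulAction.mem_orbit_iff.2 ⟨g, rfl⟩))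

namespace Slice

variable (S : Slice I G M k)

theorem orb_mem_image_sat {y : M} : orb y ∈ orb '' S.sat ↔ y ∈ S.sat := by
  refine ⟨?_, fun h => ⟨y, h, rfl⟩⟩
  rintro ⟨y', hy', e⟩
  obtain ⟨g, rfl⟩ := MulAction.mem_orbit_iff.1 (MulAction.orbitRel_apply.1 (Quotient.exact e.symm))
  exact S.smul_mem g hy'

theorem ret_out_orb {y : M} (hy : y ∈ S.sat) : S.ret (orb y).out = S.ret y := by
  obtain ⟨g, hg⟩ := exists_smul_eq_out (G := G) y
  rw [← hg, S.ret_smul g hy]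

theorem orb_sec_ret {y : M} (hy : y ∈ S.sat) : orb (S.sec (S.ret y)) = orb y := by
  obtain ⟨g, hg⟩ := S.exists_smul_sec hy
  rw [← orb_smul g, hg]

variable [ContinuousConstSMul G M]

/-- The chart of the orbit space given by a slice: an orbit is sent to the parameter of the point
where it meets the slice. -/
def chart : OpenPartialHomeomorph OrbitSpace (EuclideanSpace ℝ (Fin k)) where
  toFun q := S.ret q.out
  invFun w := orb (S.sec w)
  source := orb '' S.sat
  target := S.dom
  map_source' := by
    rintro _ ⟨y, hy, rfl⟩
    rw [S.ret_out_orb hy]; exact S.ret_mem hy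
  map_target' w hw := ⟨_, S.sec_mem hw, rfl⟩
  left_inv' := by
    rintro _ ⟨y, hy, rfl⟩
    rw [S.ret_out_orb hy]; exact S.orb_sec_ret hy
  right_inv' w hw := by
    rw [S.ret_out_orb (S.sec_mem hw)]; exact S.ret_sec hw
  open_source := isOpenMap_quotient_mk'_mul _ S.isOpen_sat
  open_target := S.isOpen_dom
  continuousOn_toFun := by
    rintro _ ⟨y, hy, rfl⟩
    refine ContinuousAt.continuousWithinAt ?_
    -- the projection is open, so neighbourhoods in `M` map to neighbourhoods in the orbit space
    rw [ContinuousAt, Filter.tendsto_def]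
    intro N hN
    rw [S.ret_out_orb hy] at hN
    have h1 : {z | z ∈ S.sat ∧ S.ret z ∈ N} ∈ nhds y :=
      Filter.inter_mem (S.isOpen_sat.mem_nhds hy)
        ((S.contMDiffOn_ret.continuousOn.continuousAt (S.isOpen_sat.mem_nhds hy)).preimage_mem_nhds
          hN)
    have h2 :=
      (MulAction.isOpenQuotientMap_quotientMk (Γ := G) (T := M)).isOpenMap.image_mem_nhds h1
    refine Filter.mem_of_superset h2 ?_
    rintro _ ⟨z, ⟨hz, hzN⟩, rfl⟩
    rw [Set.mem_preimage, S.ret_out_orb hz]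
    exact hzN
  continuousOn_invFun := continuous_quot_mk.comp_continuousOn S.contMDiffOn_sec.continuousOn

theorem chart_orb {y : M} (hy : y ∈ S.sat) : S.chart (orb y) = S.ret y := S.ret_out_orb hy

end Slice

variable [ContinuousConstSMul G M]

/-- The charted space structure on the orbit space whose charts are given by the slices. -/
@[reducible]
def orbitChartedSpace (h : ∀ x : M, ∃ S : Slice I G M k, x ∈ S.sat) :
    ChartedSpace (EuclideanSpace ℝ (Fin k)) OrbitSpace where
  atlas := Set.range (fun S : Slice I G M k => S.chart)
  chartAt q := (h q.out).choose.chart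
  mem_chart_source q := ⟨q.out, (h q.out).choose_spec, Quotient.out_eq q⟩
  chart_mem_atlas _ := ⟨_, rfl⟩

/-- Changes of slices are smooth: from the slice `S` to the slice `S'`, the transition map is
`S'.ret ∘ S.sec`. -/
theorem isManifold_orbitChartedSpace (h : ∀ x : M, ∃ S : Slice I G M k, x ∈ S.sat) :
    @IsManifold _ _ _ _ _ _ _ (𝓡 k) ∞ OrbitSpace _ (orbitChartedSpace h) := by
  let := orbitChartedSpace h
  refine isManifold_of_contDiffOn (𝓡 k) ∞ OrbitSpace ?_
  rintro _ _ ⟨S, rfl⟩ ⟨S', rfl⟩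
  rw [← contMDiffOn_iff_contDiffOn]
  have key : ContMDiffOn (𝓡 k) (𝓡 k) ∞ (fun w => S'.ret (S.sec w))
      (S.dom ∩ S.sec ⁻¹' S'.sat) :=
    S'.contMDiffOn_ret.comp (S.contMDiffOn_sec.mono Set.inter_subset_left)
      Set.inter_subset_right
  have hsub : ∀ w ∈ (S.chart.symm ≫ₕ S'.chart).source, w ∈ S.dom ∩ S.sec ⁻¹' S'.sat := by
    intro w hw
    rw [OpenPartialHomeomorph.trans_source] at hw
    exact ⟨hw.1, S'.orb_mem_image_sat.1 hw.2⟩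
  refine (key.mono ?_).congr ?_
  · rintro w ⟨hw, -⟩; exact hsub w hw
  · rintro w ⟨hw, -⟩
    exact S'.chart_orb (hsub w hw).2

theorem contMDiff_orb (h : ∀ x : M, ∃ S : Slice I G M k, x ∈ S.sat) :
    letI := orbitChartedSpace h
    ContMDiff I (𝓡 k) ∞ orb := by
  let := orbitChartedSpace h
  intro y
  rw [contMDiffAt_iff_target]
  refine ⟨continuous_quot_mk.continuousAt, ?_⟩
  set S := (h (orb y).out).choose with hS
  have hy : y ∈ S.sat := by
    refine S.orb_mem_image_sat.1 ?_
    exact ⟨_, (h (orb y).out).choose_spec, Quotient.out_eq (orb y)⟩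
  have h1 : ContMDiffAt I (𝓡 k) ∞ S.ret y :=
    S.contMDiffOn_ret.contMDiffAt (S.isOpen_sat.mem_nhds hy)
  refine h1.congr_of_eventuallyEq ?_
  filter_upwards [S.isOpen_sat.mem_nhds hy] with z hz
  exact S.chart_orb hz

theorem exists_local_section_orb (h : ∀ x : M, ∃ S : Slice I G M k, x ∈ S.sat) (b : OrbitSpace) :
    letI := orbitChartedSpace h
    ∃ s : OrbitSpace → M, ContMDiffAt (𝓡 k) I ∞ s b ∧ ∀ᶠ b' in nhds b, orb (s b') = b' := by
  let := orbitChartedSpace h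
  have := isManifold_orbitChartedSpace h
  set S := (h b.out).choose with hS
  have hb : b ∈ S.chart.source := mem_chart_source (EuclideanSpace ℝ (Fin k)) b
  refine ⟨fun b' => S.sec (S.chart b'), ?_, ?_⟩
  · have h1 : ContMDiffAt (𝓡 k) (𝓡 k) ∞ S.chart b := contMDiffAt_extChartAt (I := 𝓡 k) (x := b)
    exact ContMDiffAt.comp (g := S.sec) b
      (S.contMDiffOn_sec.contMDiffAt (S.isOpen_dom.mem_nhds (S.chart.map_source hb))) h1
  · filter_upwards [S.chart.open_source.mem_nhds hb] with b' hb'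
    exact S.chart.left_inv hb'

/-- The slice theorem makes the orbit space a smooth manifold such that the projection is a
submersion: the projection is smooth and has smooth local sections. -/
theorem exists_isManifold_orbitSpace (h : ∀ x : M, ∃ S : Slice I G M k, x ∈ S.sat) :
    ∃ (_ : ChartedSpace (EuclideanSpace ℝ (Fin k)) OrbitSpace)
      (_ : IsManifold (𝓡 k) ∞ OrbitSpace),
      ContMDiff I (𝓡 k) ∞ orb ∧
      ∀ b : OrbitSpace, ∃ s : OrbitSpace → M,
        ContMDiffAt (𝓡 k) I ∞ s b ∧ ∀ᶠ b' in nhds b, orb (s b') = b' :=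
  ⟨orbitChartedSpace h, isManifold_orbitChartedSpace h, contMDiff_orb h,
    exists_local_section_orb h⟩

end Orbits

/-! ### Topology of the tangent bundle -/

section TangentTopology

variable {E : Type*} [NormedAddCommGroup E] [NormedSpace ℝ E] {H : Type*} [TopologicalSpace H]
  (I : ModelWithCorners ℝ E H) (Q : Type*) [TopologicalSpace Q] [ChartedSpace H Q]
  [IsManifold I 1 Q]

theorem t2Space_tangentBundle [T2Space Q] : T2Space (TangentBundle I Q) := by
  refine ⟨fun v w hvw => ?_⟩
  by_cases hp : v.proj = w.proj
  · set e := trivializationAt E (TangentSpace I : Q → Type _) v.proj with he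
    have hv : v ∈ e.source := e.mem_source.2 (FiberBundle.mem_baseSet_trivializationAt' v.proj)
    have hw : w ∈ e.source :=
      e.mem_source.2 (hp ▸ FiberBundle.mem_baseSet_trivializationAt' v.proj)
    have h2 : (e v).2 ≠ (e w).2 := by
      intro h
      exact hvw (e.injOn hv hw (Prod.ext ((e.coe_fst hv).trans (hp.trans (e.coe_fst hw).symm)) h))
    obtain ⟨U, W, hU, hW, hvU, hwW, hd⟩ := t2_separation h2
    refine ⟨e.source ∩ e ⁻¹' (Prod.snd ⁻¹' U), e.source ∩ e ⁻¹' (Prod.snd ⁻¹' W),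
      e.continuousOn.isOpen_inter_preimage e.open_source (hU.preimage continuous_snd),
      e.continuousOn.isOpen_inter_preimage e.open_source (hW.preimage continuous_snd),
      ⟨hv, hvU⟩, ⟨hw, hwW⟩, ?_⟩
    exact Set.disjoint_left.2 fun z hz hz' => Set.disjoint_left.1 hd hz.2 hz'.2
  · exact separated_by_continuous (FiberBundle.continuous_proj E (TangentSpace I : Q → Type _)) hp

theorem secondCountableTopology_tangentBundle [SecondCountableTopology Q]
    [SecondCountableTopology H] [SecondCountableTopology E] :
    SecondCountableTopology (TangentBundle I Q) := by
  obtain ⟨s, hs, hU⟩ := TopologicalSpace.countable_cover_nhds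
    (f := fun q : Q => (chartAt H q).source) (fun q => chart_source_mem_nhds H q)
  have : SecondCountableTopology (ModelProd H E) :=
    inferInstanceAs (SecondCountableTopology (H × E))
  refine ChartedSpace.secondCountable_of_countable_cover (ModelProd H E)
    (s := (fun q : Q => (⟨q, 0⟩ : TangentBundle I Q)) '' s) ?_ (hs.image _)
  refine Set.eq_univ_of_forall fun v => ?_
  have : v.proj ∈ ⋃ q ∈ s, (chartAt H q).source := hU ▸ Set.mem_univ _
  simp only [Set.mem_iUnion] at this ⊢
  obtain ⟨q, hq, hv⟩ := this
  refine ⟨_, ⟨q, hq, rfl⟩, ?_⟩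
  rw [TangentBundle.mem_chart_source_iff]
  exact hv

end TangentTopology

/-! ### The lifted action -/

section LiftedAction

variable {A : Type*} [NormedAddCommGroup A] [NormedSpace ℝ A] {HA : Type*} [TopologicalSpace HA]
  (IA : ModelWithCorners ℝ A HA) (G : Type*) [TopologicalSpace G] [ChartedSpace HA G] [Group G]
  [IsManifold IA ∞ G]
  {E : Type*} [NormedAddCommGroup E] [NormedSpace ℝ E] {H : Type*} [TopologicalSpace H]
  (I : ModelWithCorners ℝ E H) (Q : Type*) [TopologicalSpace Q] [ChartedSpace H Q]
  [IsManifold I ∞ Q] [MulAction G Q] [ContMDiffSMul IA I ∞ G Q]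

theorem contMDiffSMul_liftedAction :
    letI := liftedAction IA I G Q
    ContMDiffSMul IA I.tangent ∞ G (TangentBundle I Q) :=
  letI := liftedAction IA I G Q
  ⟨contMDiff_tangentMap_family (P := fun (g : G) (q : Q) => g • q)
    (contMDiff_smul (I := IA) (I' := I) (n := ∞) (G := G) (M := Q))⟩

omit [IsManifold IA ∞ G] [IsManifold I ∞ Q] in
theorem isCancelSMul_liftedAction [IsCancelSMul G Q] :
    letI := liftedAction IA I G Q
    IsCancelSMul G (TangentBundle I Q) :=
  letI := liftedAction IA I G Q
  { left_cancel' := fun a _ _ h => MulAction.injective a h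
    right_cancel' := fun a b v h => by
      have h1 : a • v.proj = b • v.proj :=
        congrArg (Bundle.TotalSpace.proj : TangentBundle I Q → Q) h
      exact IsCancelSMul.right_cancel a b v.proj h1 }

/-- Properness passes to the lifted action because the projection `TQ → Q` is equivariant. -/
theorem properSMul_liftedAction [T2Space Q] [ProperSMul G Q] :
    letI := liftedAction IA I G Q
    ProperSMul G (TangentBundle I Q) := by
  let := liftedAction IA I G Q
  have := contMDiffSMul_liftedAction IA G I Q
  have := t2Space_tangentBundle I Q
  have hc : ContinuousSMul G (TangentBundle I Q) :=
    ⟨(contMDiff_smul (I := IA) (I' := I.tangent) (n := ∞) (G := G)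
      (M := TangentBundle I Q)).continuous⟩
  refine properSMul_iff_continuousSMul_ultrafilter_tendsto_t2.2 ⟨hc, fun 𝒰 v₁ v₂ h => ?_⟩
  have hπ : Continuous (Bundle.TotalSpace.proj : TangentBundle I Q → Q) :=
    FiberBundle.continuous_proj E (TangentSpace I : Q → Type _)
  set p : G × TangentBundle I Q → G × Q := Prod.map id Bundle.TotalSpace.proj with hp
  obtain ⟨g, -, hg⟩ := (properSMul_iff_continuousSMul_ultrafilter_tendsto.1
    (inferInstanceAs (ProperSMul G Q))).2 (𝒰.map p) v₁.proj v₂.proj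
    (((hπ.prodMap hπ).tendsto (v₁, v₂)).comp h)
  exact ⟨g, hg⟩

end LiftedAction

/-! ### Projection of invariant vector fields -/

section Projection

variable {E : Type*} [NormedAddCommGroup E] [NormedSpace ℝ E] {H : Type*} [TopologicalSpace H]
  {J : ModelWithCorners ℝ E H} {P : Type*} [TopologicalSpace P] [ChartedSpace H P]
  {F : Type*} [NormedAddCommGroup F] [NormedSpace ℝ F] {H' : Type*} [TopologicalSpace H']
  {K : ModelWithCorners ℝ F H'} {B : Type*} [TopologicalSpace B] [ChartedSpace H' B]
  {π : P → B}

theorem surjective_mfderiv_of_section (hπ : ContMDiff J K ∞ π) {s : B → P} {b : B}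
    (hs : ContMDiffAt K J ∞ s b) (h : ∀ᶠ b' in nhds b, π (s b') = b') :
    Function.Surjective (mfderiv J K π (s b) : E →L[ℝ] F) := fun w =>
  ⟨(mfderiv K J s b : F →L[ℝ] E) w,
    (mfderiv_apply_mfderiv_of_eventuallyEq (h := id) (hπ.mdifferentiable (by simp) _)
      (hs.mdifferentiableAt (by simp)) h w).trans
      (DFunLike.congr_fun (mfderiv_id (I := K) (x := b)) w)⟩

theorem surjective_mfderiv_of_comp_eq (hπ : ContMDiff J K ∞ π) {f : P → P} (hf : ContMDiff J J ∞ f)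
    (h : ∀ p, π (f p) = π p) {p : P}
    (hp : Function.Surjective (mfderiv J K π p : E →L[ℝ] F)) :
    Function.Surjective (mfderiv J K π (f p) : E →L[ℝ] F) := fun w => by
  obtain ⟨v, hv⟩ := hp w
  exact ⟨(mfderiv J J f p : E →L[ℝ] E) v,
    (mfderiv_apply_mfderiv_of_eventuallyEq (h := π) (hπ.mdifferentiable (by simp) _)
      (hf.mdifferentiable (by simp) _) (.of_forall h) v).trans hv⟩

/-- A vector field whose image under the derivative of `π` is constant along the fibres of `π`
descends to a unique vector field on the base. It is smooth because `π` has smooth local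
sections. -/
theorem existsUnique_projected_vectorField [IsManifold J ∞ P] [IsManifold K ∞ B]
    (hπ : ContMDiff J K ∞ π)
    (hs : ∀ b, ∃ s : B → P, ContMDiffAt K J ∞ s b ∧ ∀ᶠ b' in nhds b, π (s b') = b')
    {W : (p : P) → TangentSpace J p} (hW : IsSmoothVectorField J W)
    (hconst : ∀ p p', π p = π p' →
      (mfderiv J K π p : E →L[ℝ] F) (W p) = (mfderiv J K π p' : E →L[ℝ] F) (W p')) :
    ∃! V : (b : B) → TangentSpace K b, IsSmoothVectorField K V ∧
      ∀ p, mfderiv J K π p (W p) = V (π p) := by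
  have hsurj : Function.Surjective π := fun b => by
    obtain ⟨s, -, h⟩ := hs b
    exact ⟨s b, h.self_of_nhds⟩
  choose s₀ hs₀ using hsurj
  refine ⟨fun b => (mfderiv J K π (s₀ b) : E →L[ℝ] F) (W (s₀ b)), ⟨fun b => ?_, fun p => ?_⟩, ?_⟩
  · obtain ⟨s, hsb, h⟩ := hs b
    have h1 : ContMDiffAt K K.tangent ∞
        (fun b => tangentMap J K π (⟨s b, W (s b)⟩ : TangentBundle J P)) b :=
      ContMDiffAt.comp (g := tangentMap J K π) b
        ((hπ.contMDiff_tangentMap (m := ∞) (by simp)) _)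
        (ContMDiffAt.comp (g := fun p => (⟨p, W p⟩ : TangentBundle J P)) b (hW (s b)) hsb)
    refine h1.congr_of_eventuallyEq ?_
    filter_upwards [h] with b' hb'
    have h2 := hconst (s₀ b') (s b') ((hs₀ b').trans hb'.symm)
    have key : ∀ (b'' : B) (v v' : F), b' = b'' → v = v' →
        (⟨b', v⟩ : TangentBundle K B) = ⟨b'', v'⟩ := by
      rintro _ _ _ rfl rfl; rfl
    exact key _ _ _ hb'.symm h2
  · exact hconst _ _ (hs₀ (π p)).symm
  · rintro V ⟨-, hV⟩
    funext b
    have key : ∀ b', b' = b → (V b' : F) = V b := by rintro _ rfl; rfl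
    exact (key _ (hs₀ b)).symm.trans (hV (s₀ b)).symm

end Projection

end ContactReduction

end

theorem mainTheorem1 (n d : ℕ)
    (Q : Type*) [TopologicalSpace Q] [T2Space Q] [SecondCountableTopology Q]
    [ChartedSpace (EuclideanSpace ℝ (Fin n)) Q] [IsManifold (𝓡 n) ∞ Q]
    (G : Type*) [TopologicalSpace G] [T2Space G] [ConnectedSpace G]
    [ChartedSpace (EuclideanSpace ℝ (Fin d)) G] [Group G] [LieGroup (𝓡 d) ∞ G]
    [MulAction G Q] [ContMDiffSMul (𝓡 d) (𝓡 n) ∞ G Q] [IsCancelSMul G Q] [ProperSMul G Q]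
    (L : TQR (𝓡 n) Q → ℝ)
    (hL : ContMDiff (modelTQR (𝓡 n)) 𝓘(ℝ, ℝ) ∞ L)
    (hreg : IsRegularLagrangian (𝓡 n) L)
    (hinv : ∀ (g : G) (p : TQR (𝓡 n) Q),
      L (actTQR (𝓡 n) g p) = L p)
    (Γ : (p : TQR (𝓡 n) Q) →
      TangentSpace (modelTQR (𝓡 n)) p)
    (hΓ : IsHerglotz (𝓡 n) L Γ) :
    -- `Γ` commutes with the complete lifts of the fundamental vector fields
    (∀ ξ : GroupLieAlgebra (𝓡 d) G,
      VectorField.mlieBracket (modelTQR (𝓡 n))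
        (completeLift (𝓡 n)
          (fundamentalField (𝓡 d) (𝓡 n) ξ)) Γ = 0) ∧
    -- `Γ` is invariant under the action of `G` on `TQ × ℝ`
    (∀ (g : G) (p : TQR (𝓡 n) Q),
      mfderiv (modelTQR (𝓡 n)) (modelTQR (𝓡 n))
        (actTQR (𝓡 n) g) p (Γ p) = Γ (actTQR (𝓡 n) g p)) ∧
    -- `TQ/G` is a smooth manifold such that `π : TQ → TQ/G` is a smooth submersion,
    -- and `Γ` projects to a unique smooth vector field on `TQ/G × ℝ`
    T2Space (TQmodG (𝓡 d) (𝓡 n) G Q) ∧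
    SecondCountableTopology (TQmodG (𝓡 d) (𝓡 n) G Q) ∧
    ∃ (_ : ChartedSpace (EuclideanSpace ℝ (Fin (2 * n - d)))
          (TQmodG (𝓡 d) (𝓡 n) G Q))
      (_ : IsManifold (𝓡 (2 * n - d)) ∞ (TQmodG (𝓡 d) (𝓡 n) G Q)),
      ContMDiff (𝓡 n).tangent (𝓡 (2 * n - d)) ∞
        (projTQ (Q := Q) (𝓡 d) (𝓡 n) G) ∧
      (∀ v : TangentBundle (𝓡 n) Q, Function.Surjective
        (mfderiv (𝓡 n).tangent (𝓡 (2 * n - d))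
          (projTQ (Q := Q) (𝓡 d) (𝓡 n) G) v)) ∧
      ∃! Γred : (b : TQmodG (𝓡 d) (𝓡 n) G Q × ℝ) →
          TangentSpace ((𝓡 (2 * n - d)).prod 𝓘(ℝ, ℝ)) b,
        IsSmoothVectorField ((𝓡 (2 * n - d)).prod 𝓘(ℝ, ℝ)) Γred ∧
        ∀ p : TQR (𝓡 n) Q,
          mfderiv (modelTQR (𝓡 n)) ((𝓡 (2 * n - d)).prod 𝓘(ℝ, ℝ))
            (projTQR (𝓡 d) (𝓡 n) G) p (Γ p) =
          Γred (projTQR (𝓡 d) (𝓡 n) G p) := by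
  have hmG : IsManifold (𝓡 d) ∞ G := ContMDiffMul.toIsManifold (G := G)
  have hsmul : ContMDiff ((𝓡 d).prod (𝓡 n)) (𝓡 n) ∞ (fun z : G × Q => z.1 • z.2) := contMDiff_smul
  have hΓinv (g : G) (p : TQR (𝓡 n) Q) :
      mfderiv (modelTQR (𝓡 n)) (modelTQR (𝓡 n)) (actTQR (𝓡 n) g) p (Γ p) =
        Γ (actTQR (𝓡 n) g p) :=
    hΓ.mfderiv_tangentLift (contMDiff_smul_left (𝓡 d) (𝓡 n) G Q g)
      (contMDiff_smul_left (𝓡 d) (𝓡 n) G Q g⁻¹) (inv_smul_smul g) (smul_inv_smul g) hL hreg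
      (hinv g) p
  let act := liftedAction (𝓡 d) (𝓡 n) G Q
  have hact := contMDiffSMul_liftedAction (𝓡 d) G (𝓡 n) Q
  have hfree := isCancelSMul_liftedAction (𝓡 d) G (𝓡 n) Q
  have hproper := properSMul_liftedAction (𝓡 d) G (𝓡 n) Q
  have hT2 := t2Space_tangentBundle (𝓡 n) Q
  have hsc := secondCountableTopology_tangentBundle (𝓡 n) Q
  have hslice (v : TangentBundle (𝓡 n) Q) :
      ∃ S : Slice (𝓡 n).tangent G (TangentBundle (𝓡 n) Q) (2 * n - d), v ∈ S.sat :=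
    exists_slice (𝓡 d) (𝓡 n).tangent v (by simp; omega)
  refine ⟨fun ξ => ?_, hΓinv, t2Space_quotient_mulAction_of_properSMul,
    ContinuousConstSMul.secondCountableTopology, ?_⟩
  -- the lifted fundamental field is the velocity field of the lifted action at the identity of `G`
  · refine mlieBracket_eq_zero_of_invariant (IA := 𝓡 d) (I := modelTQR (𝓡 n))
      (P := fun g : G => actTQR (𝓡 n) g) (contMDiff_tangentLift_family hsmul) (g := 1) ?_ ξ ?_
      hΓ.smooth hΓinv
    · intro p
      exact Prod.ext (one_smul G p.1) rfl
    · intro p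
      exact completeLift_velocity hsmul (g := 1) (one_smul G) ξ (fun q => rfl) p
  obtain ⟨ch, hman, hπ, hsec⟩ := exists_isManifold_orbitSpace hslice
  refine ⟨ch, hman, hπ, fun v => ?_, ?_⟩
  · obtain ⟨s, hs, h⟩ := hsec (projTQ (𝓡 d) (𝓡 n) G v)
    obtain ⟨g, hg⟩ := MulAction.mem_orbit_iff.1 (MulAction.orbitRel_apply.1
      (Quotient.exact h.self_of_nhds.symm))
    -- a local section gives surjectivity at one point of the orbit, and the action moves it to `v`
    have key := surjective_mfderiv_of_comp_eq hπ (f := fun v => g • v)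
      (contMDiff_smul_left (𝓡 d) (𝓡 n).tangent G (TangentBundle (𝓡 n) Q) g) (orb_smul g)
      (surjective_mfderiv_of_section hπ hs h)
    exact hg ▸ key
  have hπR : ContMDiff (modelTQR (𝓡 n)) ((𝓡 (2 * n - d)).prod 𝓘(ℝ, ℝ)) ∞
      (projTQR (Q := Q) (𝓡 d) (𝓡 n) G) := (hπ.comp contMDiff_fst).prodMk contMDiff_snd
  refine existsUnique_projected_vectorField hπR (fun b => ?_) hΓ.smooth fun p p' e => ?_
  · obtain ⟨s, hs, h⟩ := hsec b.1
    refine ⟨fun b' => (s b'.1, b'.2), (hs.comp b contMDiffAt_fst).prodMk contMDiffAt_snd, ?_⟩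
    filter_upwards [continuousAt_fst.eventually h] with b' hb'
    exact Prod.ext hb' rfl
  · obtain ⟨e1, e2⟩ := Prod.mk.inj e
    obtain ⟨g, hg⟩ := MulAction.mem_orbit_iff.1 (MulAction.orbitRel_apply.1 (Quotient.exact e1))
    obtain rfl : actTQR (𝓡 n) g p' = p := Prod.ext hg e2.symm
    -- `Γ` is constant along the orbits modulo the projection, by its invariance
    refine (congrArg _ (hΓinv g p').symm).trans ?_
    exact mfderiv_apply_mfderiv_of_eventuallyEq
      (h := projTQR (𝓡 d) (𝓡 n) G) (hπR.mdifferentiable (by simp) _)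
      ((contMDiff_tangentLift (contMDiff_smul_left (𝓡 d) (𝓡 n) G Q g)).mdifferentiable (by simp) _)
      (.of_forall fun z => Prod.ext (orb_smul g z.1) rfl) (Γ p')
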